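/- Fix $K\ge 2$ and $c>0$. For $m=0,1,2,\dots$ let $n_1^{(m)},\dots,n_K^{(m)}$ be cluster sizes such that the total size $n^{(m)}=\sum_k n_k^{(m)}$ is strictly increasing in $m$, every $n_k^{(m)}\to\infty$, and $n_{\min}^{(m)}/n_{\max}^{(m)}\to c$, where $n_{\min}^{(m)},n_{\max}^{(m)}$ are the smallest and largest cluster size. For each $m$ and $k$ let a connected graph on the $n_k^{(m)}$ nodes of cluster $k$ be given, with Laplacian $\mathbf L_k^{(m)}$. For each $p\in[0,1]$ and each $m$ consider the homogeneous random interconnection model: the random graph on all $n^{(m)}$ nodes which inside the clusters consists of the given graphs and in which the edges between nodes of different clusters are present independently with probability $p$; let $\mathbf L^{(m)}=\mathbf L^{(m)}(p)$ be its Laplacian (degree matrix minus adjacency matrix). No assumption is made on the joint distribution for different $p$ or $m$; "almost surely" below refers to each fixed $p$ separately. For the Laplacian $\mathbf L$ of a graph on $N\ge K$ nodes let $S_K(\mathbf L)=\min\{\operatorname{tr}(\mathbf X^T\mathbf L\mathbf X):\mathbf X\in\mathbb R^{N\times(K-1)},\ \mathbf X^T\mathbf X=\mathbf I,\ \mathbf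 X^T\mathbf 1=\mathbf 0\}$, which is the sum of its second to $K$-th smallest eigenvalues. Put $c^*_m=\frac1{n^{(m)}}\min_k S_K(\mathbf L_k^{(m)})$. A number $p^*\in[0,1]$ is called a *critical value* if for all $p\in[0,1]$, almost surely as $m\to\infty$: - if $p\le p^*$, then $S_K(\mathbf L^{(m)})/n^{(m)}\to (K-1)p$; - if $p>p^*$, then $$c^*_m+(K-1)\Bigl(1-\tfrac{n_{\max}^{(m)}}{n^{(m)}}\Bigr)p-o(1)\ \le\ \frac{S_K(\mathbf L^{(m)})}{n^{(m)}}\ \le\ c^*_m+(K-1)\Bigl(1-\tfrac{n_{\min}^{(m)}}{n^{(m)}}\Bigr)p+o(1).$$ It is called an *eigenvector threshold* if for all $p\in[0,1]$, almost surely, for every choice of minimizers $\mathbf Y^{(m)}$ in the definition of $S_K(\mathbf L^{(m)})$ (for all large $m$) and every $k$, with $\mathbf Y_k^{(m)}$ the block of rows of $\mathbf Y^{(m)}$ belonging to cluster $k$: - if $p<p^*$, there are $v^{(m)}\in\mathbb R^{K-1}$ with $\bigl\|\mathbf Y_k^{(m)}-\tfrac1{\sqrt{n_k^{(m)}}}\mathbf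 1 (v^{(m)})^T\bigr\|\to0$; - if $p>p^*$, then $\tfrac1{\sqrt{n_k^{(m)}}}(\mathbf Y_k^{(m)})^T\mathbf 1\to\mathbf 0$. Then: (a) If every cluster is a complete graph (for all $m$), there is a critical value $p^*$ that is also an eigenvector threshold, and every critical value satisfies $c\le p^*\le 1$. (b) If every cluster is a star graph (for all $m$), there is a critical value $p^*$ that is also an eigenvector threshold, and every critical value satisfies $p^*=0$. -/

import Mathlib

open MeasureTheory ProbabilityTheory Filter Topology

namespace RIM

/-- The node set of a graph made of clusters of sizes `s 0, …, s (K-1)`: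
a node is a pair `⟨k, a⟩`, the node `a` of cluster `k`. -/
abbrev Node {K : ℕ} (s : Fin K → ℕ) : Type := Σ k : Fin K, Fin (s k)

/-- The node pairs joining two different clusters, each unordered pair listed once
(the entries of the blocks `C i j` with `i > j`). -/
abbrev InterPair {K : ℕ} (s : Fin K → ℕ) : Type :=
  {e : Node s × Node s // e.2.1 < e.1.1}

/-- The number of nodes, as a real number. -/
def total {K : ℕ} (s : Fin K → ℕ) : ℝ := ∑ k, (s k : ℝ)

/-- The size of the smallest cluster. -/
noncomputable def nmin {K : ℕ} (s : Fin K → ℕ) : ℝ := ⨅ k, (s k : ℝ)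

/-- The size of the largest cluster. -/
noncomputable def nmax {K : ℕ} (s : Fin K → ℕ) : ℝ := ⨆ k, (s k : ℝ)

/-- The graph Laplacian `D - A`. -/
noncomputable def laplacian {V : Type} [Fintype V] [DecidableEq V] (G : SimpleGraph V) :
    Matrix V V ℝ :=
  letI : DecidableRel G.Adj := Classical.decRel _
  G.lapMatrix ℝ

/-- The matrices `X` with `K - 1` columns such that `Xᵀ X = I` and `Xᵀ 1 = 0`. -/
def feasible (V : Type) [Fintype V] (K : ℕ) : Set (Matrix V (Fin (K - 1)) ℝ) :=
  {X | X.transpose * X = 1 ∧ Matrix.mulVec X.transpose (fun _ => (1 : ℝ)) = 0}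

/-- The partial eigenvalue sum `S_K(L)`: the minimum of `trace (Xᵀ L X)` subject to `Xᵀ X = I` and
`Xᵀ 1 = 0`. For a graph Laplacian on at least `K` nodes this is the sum of the second to the
`K`-th smallest eigenvalue. -/
noncomputable def partialEigSum {V : Type} [Fintype V] (K : ℕ) (L : Matrix V V ℝ) : ℝ :=
  sInf ((fun X => (X.transpose * L * X).trace) '' feasible V K)

/-- `Y` is a solution of the spectral clustering problem for `L`, that is, of the minimization
problem defining `partialEigSum K L`. -/
def IsSpectralSolution {V : Type} [Fintype V] {K : ℕ} (L : Matrix V V ℝ)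
    (Y : Matrix V (Fin (K - 1)) ℝ) : Prop :=
  Y ∈ feasible V K ∧
    ∀ X ∈ feasible V K, (Y.transpose * L * Y).trace ≤ (X.transpose * L * X).trace

/-- The random graph `G` follows the homogeneous random interconnection model with cluster sizes
`s`, internal cluster graphs `A` and interconnection probability `p`. -/
structure IsHomogeneousRIM {Ω : Type*} [MeasurableSpace Ω] (μ : Measure Ω) {K : ℕ}
    {s : Fin K → ℕ} (A : ∀ k, SimpleGraph (Fin (s k))) (p : ℝ)
    (G : Ω → SimpleGraph (Node s)) : Prop where
  connected : ∀ k, (A k).Connected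
  internal : ∀ ω k (a b : Fin (s k)), (G ω).Adj ⟨k, a⟩ ⟨k, b⟩ ↔ (A k).Adj a b
  measurable : ∀ e : InterPair s, MeasurableSet {ω | (G ω).Adj e.1.1 e.1.2}
  indep : iIndepSet (fun e : InterPair s => {ω | (G ω).Adj e.1.1 e.1.2}) μ
  prob : ∀ e : InterPair s, μ {ω | (G ω).Adj e.1.1 e.1.2} = ENNReal.ofReal p

/-- The asymptotic regime: a sequence of models of strictly increasing total size, in which every
cluster size tends to infinity and the ratio of the smallest to the largest cluster size tends
to `c > 0`. -/
structure IsGrowing {K : ℕ} (size : ℕ → Fin K → ℕ) (c : ℝ) : Prop where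
  strictMono : StrictMono fun m => ∑ k, size m k
  tendsto_size : ∀ k, Tendsto (fun m => size m k) atTop atTop
  tendsto_ratio : Tendsto (fun m => nmin (size m) / nmax (size m)) atTop (𝓝 c)
  pos : 0 < c

section Threshold

variable {Ω : Type*} [MeasurableSpace Ω] (μ : Measure Ω) {K : ℕ} {size : ℕ → Fin K → ℕ}

/-- `n⁻¹ min_k S_K(L_k)`, whose limit, when it exists, is denoted `c*`. -/
noncomputable def cStar {s : Fin K → ℕ} (A : ∀ k, SimpleGraph (Fin (s k))) : ℝ :=
  (⨅ k, partialEigSum K (laplacian (A k))) / total s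

/-- `n⁻¹ S_K(L)` for a graph on the nodes of the clusters. -/
noncomputable def normalizedSum {s : Fin K → ℕ} (H : SimpleGraph (Node s)) : ℝ :=
  partialEigSum K (laplacian H) / total s

/-- `pstar` is a critical value (phase transition threshold) of the partial eigenvalue sum.
Here `G p m` is the `m`-th random graph with interconnection probability `p`, and `A m k` is its
`k`-th internal cluster graph. The two bounds above the threshold are asymptotic and are written
so that neither the limit `c*` nor the limits of `n_max / n` and `n_min / n` have to exist. -/
structure IsCriticalValue (A : ∀ m k, SimpleGraph (Fin (size m k)))
    (G : ℝ → (m : ℕ) → Ω → SimpleGraph (Node (size m))) (pstar : ℝ) : Prop where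
  mem : pstar ∈ Set.Icc (0 : ℝ) 1
  below : ∀ p ∈ Set.Icc (0 : ℝ) 1, p ≤ pstar →
    ∀ᵐ ω ∂μ, Tendsto (fun m => normalizedSum (G p m ω)) atTop (𝓝 (((K : ℝ) - 1) * p))
  above : ∀ p ∈ Set.Icc (0 : ℝ) 1, pstar < p →
    ∀ᵐ ω ∂μ, ∀ ε > 0, ∀ᶠ m in atTop,
      cStar (A m) + ((K : ℝ) - 1) * (1 - nmax (size m) / total (size m)) * p - ε
          ≤ normalizedSum (G p m ω) ∧
        normalizedSum (G p m ω)
          ≤ cStar (A m) + ((K : ℝ) - 1) * (1 - nmin (size m) / total (size m)) * p + ε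

/-- `pstar` is a threshold for the success of spectral clustering. Below it, the rows of the
solution `Y` belonging to cluster `k` asymptotically coincide: `Y_k - 1 vᵀ / √n_k → 0` for suitable
row vectors `v` (in Frobenius norm, equivalently in spectral norm, since `Y_k` has `K - 1` columns).
Above it, `Y_k` becomes incoherent: its columns are asymptotically orthogonal to the unit vector
`1 / √n_k`. -/
structure IsEigenvectorThreshold
    (G : ℝ → (m : ℕ) → Ω → SimpleGraph (Node (size m))) (pstar : ℝ) : Prop where
  below : ∀ p ∈ Set.Icc (0 : ℝ) 1, p < pstar →
    ∀ᵐ ω ∂μ, ∀ Y : (m : ℕ) → Matrix (Node (size m)) (Fin (K - 1)) ℝ,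
      (∀ᶠ m in atTop, IsSpectralSolution (laplacian (G p m ω)) (Y m)) →
      ∀ k, ∃ v : ℕ → Fin (K - 1) → ℝ,
        Tendsto (fun m => ∑ a : Fin (size m k), ∑ j : Fin (K - 1),
          (Y m ⟨k, a⟩ j - v m j / √(size m k : ℝ)) ^ 2) atTop (𝓝 0)
  above : ∀ p ∈ Set.Icc (0 : ℝ) 1, pstar < p →
    ∀ᵐ ω ∂μ, ∀ Y : (m : ℕ) → Matrix (Node (size m)) (Fin (K - 1)) ℝ,
      (∀ᶠ m in atTop, IsSpectralSolution (laplacian (G p m ω)) (Y m)) →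
      ∀ k j, Tendsto (fun m => (∑ a : Fin (size m k), Y m ⟨k, a⟩ j) / √(size m k : ℝ))
        atTop (𝓝 0)

end Threshold

end RIM

/-! Everything rests on one concentration statement: almost surely, uniformly over sum-zero vectors
`x`, the Laplacian form of the random graph differs from that of the mean graph by `o(n) ‖x‖²`
(`ae_eventually_concentrated`). The centred inter-cluster adjacency matrix `B` is controlled by its
row sums and by the off-diagonal entries of `B Bᵀ`. Each is sub-Gaussian with parameter at most `n`,
so it exceeds `δ n` with exponentially small probability; a union bound and Borel–Cantelli finish,
for any joint law over `m`. The entrywise bounds give `‖B‖⁴ ≤ ‖B Bᵀ‖_F² = o(n⁴)`, so no finer random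
matrix theory is needed.

The problem then becomes deterministic. On sum-zero vectors the mean form is the sum of the internal
energies plus `p ∑ₖ ((n - nₖ)‖xₖ‖² + (1ᵀxₖ)²)`.

For complete clusters it equals `p n ‖x‖²` plus `1 - p` times the nonnegative terms `nₖ‖xₖ‖² -
(1ᵀxₖ)²`, which vanish on cluster-constant vectors. Hence `S_K / n → (K - 1) p` on all of `[0, 1]`,
and `p* = 1` works, with nothing to check above it. For `p < 1` near-optimality forces small
deviations inside clusters. If another `p*` is critical and `p > p*`, then `c*ₘ ≥ (K - 1) n_min / n`
and the lower bound above the threshold give `n_min / n_max ≤ p + o(1)`, so `c ≤ p`; let `p`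
decrease to `p*`.

For star clusters, vectors on the largest star that sum to zero and vanish at its hub have internal
energy only `‖x‖²`. So `c*ₘ → 0` and `S_K / n = (K - 1)(1 - n_max / n) p + o(1)`. As `n_max / n ≥ 1
/ K`, this stays below `(K - 1) p` for every `p > 0`, which forces `p* = 0`; the term `(1ᵀxₖ)²`
gives the incoherence of the minimizers. -/

namespace RIM

/-! ### Laplacian quadratic forms and the variational problem -/

open Classical in
/-- The adjacency indicator of a graph. -/
noncomputable def adjWeight {V : Type} (G : SimpleGraph V) (u v : V) : ℝ :=
  if G.Adj u v then 1 else 0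

/-- The quadratic form of the graph Laplacian. -/
noncomputable def energy {V : Type} [Fintype V] (G : SimpleGraph V) (x : V → ℝ) : ℝ :=
  (∑ u, ∑ v, adjWeight G u v * (x u - x v) ^ 2) / 2

theorem adjWeight_nonneg {V : Type} (G : SimpleGraph V) (u v : V) : 0 ≤ adjWeight G u v := by
  unfold adjWeight; split_ifs <;> norm_num

theorem adjWeight_le_one {V : Type} (G : SimpleGraph V) (u v : V) : adjWeight G u v ≤ 1 := by
  unfold adjWeight; split_ifs <;> norm_num

theorem adjWeight_comm {V : Type} (G : SimpleGraph V) (u v : V) :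
    adjWeight G u v = adjWeight G v u := by
  unfold adjWeight; classical exact if_congr (G.adj_comm u v) rfl rfl

theorem energy_nonneg {V : Type} [Fintype V] (G : SimpleGraph V) (x : V → ℝ) :
    0 ≤ energy G x :=
  div_nonneg (Finset.sum_nonneg fun u _ => Finset.sum_nonneg fun v _ =>
    mul_nonneg (adjWeight_nonneg G u v) (sq_nonneg _)) (by norm_num)

theorem trace_laplacian {V : Type} [Fintype V] [DecidableEq V] {K : ℕ} (G : SimpleGraph V)
    (X : Matrix V (Fin (K - 1)) ℝ) :
    (X.transpose * laplacian G * X).trace = ∑ j, energy G (fun v => X v j) := by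
  classical
  unfold Matrix.trace
  refine Finset.sum_congr rfl fun j _ => ?_
  have h := SimpleGraph.lapMatrix_toLinearMap₂' (R := ℝ) G (fun v => X v j)
  rw [Matrix.toLinearMap₂'_apply'] at h
  have e : energy G (fun v => X v j)
      = (∑ i : V, ∑ k : V, if G.Adj i k then (X i j - X k j) ^ 2 else 0) / 2 := by
    simp only [energy, adjWeight, ite_mul, one_mul, zero_mul]
  rw [e, ← h, Matrix.diag_apply, Matrix.mul_assoc]
  have e2 : laplacian G = G.lapMatrix ℝ := by
    unfold laplacian; congr!
  rw [e2]
  rfl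

theorem feasible_iff {V : Type} [Fintype V] {K : ℕ} (X : Matrix V (Fin (K - 1)) ℝ) :
    X ∈ feasible V K ↔ (∀ i j, ∑ v, X v i * X v j = if i = j then 1 else 0) ∧
      ∀ j, ∑ v, X v j = 0 := by
  unfold feasible
  simp only [Set.mem_ofPred_eq, ← Matrix.ext_iff, funext_iff, Matrix.mul_apply,
    Matrix.transpose_apply, Matrix.one_apply, Matrix.mulVec, dotProduct, mul_one, Pi.zero_apply]

theorem feasible.sum_sq {V : Type} [Fintype V] {K : ℕ} {X : Matrix V (Fin (K - 1)) ℝ}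
    (h : X ∈ feasible V K) (j : Fin (K - 1)) : ∑ v, X v j ^ 2 = 1 := by
  simpa [sq] using ((feasible_iff X).1 h).1 j j

theorem feasible.sum_eq_zero {V : Type} [Fintype V] {K : ℕ} {X : Matrix V (Fin (K - 1)) ℝ}
    (h : X ∈ feasible V K) (j : Fin (K - 1)) : ∑ v, X v j = 0 :=
  ((feasible_iff X).1 h).2 j

theorem partialEigSum_le {V : Type} [Fintype V] [DecidableEq V] {K : ℕ} (G : SimpleGraph V)
    {X : Matrix V (Fin (K - 1)) ℝ} (h : X ∈ feasible V K) :
    partialEigSum K (laplacian G) ≤ ∑ j, energy G (fun v => X v j) := by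
  rw [← trace_laplacian]
  refine csInf_le ⟨0, ?_⟩ ⟨X, h, rfl⟩
  rintro _ ⟨Z, -, rfl⟩
  simp only [trace_laplacian]
  exact Finset.sum_nonneg fun j _ => energy_nonneg G _

/-- Nonemptiness cannot be dropped: over an empty feasible set `sInf` takes the value 0. -/
theorem le_partialEigSum {V : Type} [Fintype V] [DecidableEq V] {K : ℕ} (G : SimpleGraph V)
    (hne : (feasible V K).Nonempty) {b : ℝ}
    (h : ∀ X ∈ feasible V K, b ≤ ∑ j, energy G (fun v => X v j)) :
    b ≤ partialEigSum K (laplacian G) := by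
  refine le_csInf (hne.image _) ?_
  rintro _ ⟨Z, hZ, rfl⟩
  simpa only [trace_laplacian] using h Z hZ

theorem partialEigSum_nonneg {V : Type} [Fintype V] [DecidableEq V] (K : ℕ) (G : SimpleGraph V) :
    0 ≤ partialEigSum K (laplacian G) := by
  refine Real.sInf_nonneg ?_
  rintro _ ⟨Z, -, rfl⟩
  simp only [trace_laplacian]
  exact Finset.sum_nonneg fun j _ => energy_nonneg G _

theorem IsSpectralSolution.energy_le {V : Type} [Fintype V] [DecidableEq V] {K : ℕ}
    {G : SimpleGraph V} {Y : Matrix V (Fin (K - 1)) ℝ}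
    (hY : IsSpectralSolution (laplacian G) Y) {X : Matrix V (Fin (K - 1)) ℝ}
    (hX : X ∈ feasible V K) :
    ∑ j, energy G (fun v => Y v j) ≤ ∑ j, energy G (fun v => X v j) := by
  simpa only [trace_laplacian] using hY.2 X hX

theorem sum_sum_sub_sq {V : Type} [Fintype V] (x : V → ℝ) :
    (∑ u, ∑ v, (x u - x v) ^ 2) / 2 = Fintype.card V * ∑ v, x v ^ 2 - (∑ v, x v) ^ 2 := by
  have : ∀ u v, (x u - x v) ^ 2 = x u ^ 2 - 2 * (x u * x v) + x v ^ 2 := fun u v => by ring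
  simp only [this, Finset.sum_add_distrib, Finset.sum_sub_distrib, Finset.sum_const,
    ← Finset.mul_sum, ← Finset.sum_mul, Finset.card_univ, nsmul_eq_mul]
  ring

theorem energy_top {V : Type} [Fintype V] (x : V → ℝ) :
    energy (⊤ : SimpleGraph V) x = Fintype.card V * ∑ v, x v ^ 2 - (∑ v, x v) ^ 2 := by
  rw [← sum_sum_sub_sq, energy]
  congr 1
  refine Finset.sum_congr rfl fun u _ => Finset.sum_congr rfl fun v _ => ?_
  by_cases h : u = v <;> simp [adjWeight, h]

/-- Every edge joins the hub, where `x` vanishes, to a leaf, so it contributes the square of the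
leaf's value. -/
theorem energy_starGraph {V : Type} [Fintype V] [DecidableEq V] (r : V) (x : V → ℝ)
    (hr : x r = 0) : energy (SimpleGraph.starGraph r) x = ∑ v, x v ^ 2 := by
  have key : ∀ u v, adjWeight (SimpleGraph.starGraph r) u v * (x u - x v) ^ 2
      = (if u = r then x v ^ 2 else 0) + (if v = r then x u ^ 2 else 0) := by
    intro u v
    by_cases hu : u = r <;> by_cases hv : v = r
    · subst hu; subst hv; simp [adjWeight, hr]
    · subst hu
      have : u ≠ v := fun h => hv h.symm
      simp [adjWeight, hr, this, hv]
    · subst hv; simp [adjWeight, hr, hu]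
    · simp [adjWeight, hu, hv]
  simp only [energy, key, Finset.sum_add_distrib, Finset.sum_ite_eq', Finset.mem_univ, if_true,
    Finset.sum_comm (γ := V) (f := fun u v => if u = r then x v ^ 2 else 0)]
  ring

/-! ### Operator norm bounds from Gram entries -/

/-- A bilinear form bound through the Frobenius norm of the Gram matrix of the rows. -/
theorem bilin_pow_four_le {V : Type} [Fintype V] (B : V → V → ℝ) (x : V → ℝ) :
    (∑ u, ∑ v, B u v * (x u * x v)) ^ 4
      ≤ (∑ v, x v ^ 2) ^ 4 * ∑ u, ∑ v, (∑ w, B u w * B v w) ^ 2 := by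
  set y : V → ℝ := fun w => ∑ u, B u w * x u with hy
  set S := ∑ v, x v ^ 2
  set M := ∑ u, ∑ v, (∑ w, B u w * B v w) ^ 2 with hM
  have h1 : ∑ u, ∑ v, B u v * (x u * x v) = ∑ w, y w * x w := by
    rw [Finset.sum_comm]
    refine Finset.sum_congr rfl fun w _ => ?_
    rw [hy, Finset.sum_mul]
    exact Finset.sum_congr rfl fun u _ => by ring
  -- Cauchy–Schwarz is used twice: here for `y = Bᵀx` against `x`, then over pairs of rows, where
  -- the Gram matrix appears.
  have h2 : (∑ w, y w * x w) ^ 2 ≤ (∑ w, y w ^ 2) * S := Finset.sum_mul_sq_le_sq_mul_sq _ _ _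
  have h3 : ∑ w, y w ^ 2 = ∑ e : V × V, (∑ w, B e.1 w * B e.2 w) * (x e.1 * x e.2) := by
    simp only [Fintype.sum_prod_type, hy, sq, Finset.sum_mul, Finset.mul_sum]
    rw [Finset.sum_comm]
    refine Finset.sum_congr rfl fun u _ => ?_
    rw [Finset.sum_comm]
    refine Finset.sum_congr rfl fun v _ => Finset.sum_congr rfl fun w _ => by ring
  have h4 : (∑ w, y w ^ 2) ^ 2 ≤ M * S ^ 2 := by
    rw [h3]
    refine (Finset.sum_mul_sq_le_sq_mul_sq _ _ _).trans (le_of_eq ?_)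
    rw [Fintype.sum_prod_type, Fintype.sum_prod_type, ← hM]
    congr 1
    simp only [mul_pow, ← Finset.mul_sum, ← Finset.sum_mul]
    exact (sq _).symm
  rw [h1]
  calc (∑ w, y w * x w) ^ 4 = ((∑ w, y w * x w) ^ 2) ^ 2 := by ring
    _ ≤ ((∑ w, y w ^ 2) * S) ^ 2 := pow_le_pow_left₀ (sq_nonneg _) h2 2
    _ = (∑ w, y w ^ 2) ^ 2 * S ^ 2 := by ring
    _ ≤ (M * S ^ 2) * S ^ 2 := mul_le_mul_of_nonneg_right h4 (sq_nonneg _)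
    _ = S ^ 4 * M := by ring

/-- The `N` diagonal Gram entries are at most `N` and contribute `N³`; the off-diagonal ones
contribute at most `δ²N⁴`. `hcard` absorbs the first into the second, and `hδη` makes the total at
most `(ηN)⁴`. -/
theorem abs_bilin_le {V : Type} [Fintype V] [DecidableEq V] (B : V → V → ℝ) {η δ : ℝ}
    (hη : 0 ≤ η) (hδη : 2 * δ ^ 2 ≤ η ^ 4)
    (hcard : 1 ≤ δ ^ 2 * Fintype.card V) (hB : ∀ u v, |B u v| ≤ 1)
    (hoff : ∀ u v, u ≠ v → |∑ w, B u w * B v w| ≤ δ * Fintype.card V) (x : V → ℝ) :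
    |∑ u, ∑ v, B u v * (x u * x v)| ≤ η * Fintype.card V * ∑ v, x v ^ 2 := by
  set N : ℝ := (Fintype.card V : ℝ) with hN
  have hN0 : 0 ≤ N := Nat.cast_nonneg _
  have hS : 0 ≤ ∑ v, x v ^ 2 := Finset.sum_nonneg fun v _ => sq_nonneg _
  have hdiag : ∀ u, (∑ w, B u w * B u w) ^ 2 ≤ N ^ 2 := by
    intro u
    refine pow_le_pow_left₀ (Finset.sum_nonneg fun w _ => mul_self_nonneg _) ?_ 2
    calc ∑ w, B u w * B u w ≤ ∑ w : V, (1 : ℝ) := Finset.sum_le_sum fun w _ => by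
          have := hB u w; nlinarith [abs_mul_abs_self (B u w), abs_nonneg (B u w)]
      _ = N := by simp [hN]
  have hM : ∑ u, ∑ v, (∑ w, B u w * B v w) ^ 2 ≤ N ^ 3 + δ ^ 2 * N ^ 4 := by
    calc ∑ u, ∑ v, (∑ w, B u w * B v w) ^ 2
        ≤ ∑ u, ∑ v, ((if u = v then N ^ 2 else 0) + (δ * N) ^ 2) := by
          refine Finset.sum_le_sum fun u _ => Finset.sum_le_sum fun v _ => ?_
          by_cases h : u = v
          · subst h
            rw [if_pos rfl]
            have := hdiag u
            nlinarith [sq_nonneg (δ * N)]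
          · rw [if_neg h, zero_add]
            exact sq_le_sq' (by linarith [(abs_le.1 (hoff u v h)).1])
              (abs_le.1 (hoff u v h)).2
      _ = N ^ 3 + δ ^ 2 * N ^ 4 := by
          simp [Finset.sum_add_distrib, ← hN]; ring
  have hM2 : N ^ 3 + δ ^ 2 * N ^ 4 ≤ (η * N) ^ 4 := by
    have : N ^ 3 * 1 ≤ N ^ 3 * (δ ^ 2 * N) := mul_le_mul_of_nonneg_left hcard (by positivity)
    have h2 := mul_le_mul_of_nonneg_right hδη (pow_nonneg hN0 4)
    nlinarith
  refine le_of_pow_le_pow_left₀ (n := 4) (by norm_num) (by positivity) ?_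
  rw [show |∑ u, ∑ v, B u v * (x u * x v)| ^ 4 = (∑ u, ∑ v, B u v * (x u * x v)) ^ 4 from
    Even.pow_abs (by decide) _]
  refine (bilin_pow_four_le B x).trans ?_
  rw [mul_pow, mul_comm]
  exact mul_le_mul_of_nonneg_right (hM.trans hM2) (by positivity)

/-! ### The mean Laplacian and the fluctuation matrix -/

/-- The quadratic form of the mean Laplacian, on vectors of sum zero. -/
noncomputable def meanEnergy {K : ℕ} {s : Fin K → ℕ} (A : ∀ k, SimpleGraph (Fin (s k))) (p : ℝ)
    (x : Node s → ℝ) : ℝ :=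
  ∑ k, energy (A k) (fun a => x ⟨k, a⟩) +
    p * ∑ k, ((total s - s k) * ∑ a, x ⟨k, a⟩ ^ 2 + (∑ a, x ⟨k, a⟩) ^ 2)

/-- The Laplacian of `H` is close to the mean Laplacian, uniformly on vectors of sum zero. -/
def Concentrated {K : ℕ} {s : Fin K → ℕ} (A : ∀ k, SimpleGraph (Fin (s k))) (p δ : ℝ)
    (H : SimpleGraph (Node s)) : Prop :=
  ∀ x : Node s → ℝ, ∑ v, x v = 0 →
    |energy H x - meanEnergy A p x| ≤ δ * total s * ∑ v, x v ^ 2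

/-- The centred adjacency indicators between different clusters. -/
noncomputable def fluct {K : ℕ} {s : Fin K → ℕ} (p : ℝ) (H : SimpleGraph (Node s))
    (u v : Node s) : ℝ :=
  if u.1 = v.1 then 0 else adjWeight H u v - p

theorem card_node {K : ℕ} (s : Fin K → ℕ) : (Fintype.card (Node s) : ℝ) = total s := by
  simp [total, Fintype.card_sigma]

theorem fluct_comm {K : ℕ} {s : Fin K → ℕ} (p : ℝ) (H : SimpleGraph (Node s))
    (u v : Node s) : fluct p H u v = fluct p H v u := by
  simp only [fluct, adjWeight_comm H u v, eq_comm (a := u.1)]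

theorem abs_fluct_le {K : ℕ} {s : Fin K → ℕ} {p : ℝ} (hp : p ∈ Set.Icc (0 : ℝ) 1)
    (H : SimpleGraph (Node s)) (u v : Node s) : |fluct p H u v| ≤ 1 := by
  unfold fluct
  have h0 := adjWeight_nonneg H u v
  have h1 := adjWeight_le_one H u v
  obtain ⟨hp0, hp1⟩ := hp
  split_ifs
  · simp
  · rw [abs_le]; constructor <;> linarith

theorem sum_same_cluster {K : ℕ} {s : Fin K → ℕ} (f : Node s → Node s → ℝ) :
    ∑ u, ∑ v, (if u.1 = v.1 then f u v else 0) = ∑ k, ∑ a, ∑ b, f ⟨k, a⟩ ⟨k, b⟩ := by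
  rw [Fintype.sum_sigma]
  refine Finset.sum_congr rfl fun k _ => Finset.sum_congr rfl fun a _ => ?_
  rw [Fintype.sum_sigma, Finset.sum_eq_single k]
  · simp
  · intro l _ hl; simp [hl.symm]
  · simp

/-- Edges inside clusters are deterministic and cancel. Between clusters the weight is `p` plus a
fluctuation; the `p` part is `p` times the complete graph minus the complete clusters, and `hx`
removes the square of the total sum. -/
theorem energy_eq {K : ℕ} {s : Fin K → ℕ} {A : ∀ k, SimpleGraph (Fin (s k))} (p : ℝ)
    {H : SimpleGraph (Node s)} (hA : ∀ k a b, H.Adj ⟨k, a⟩ ⟨k, b⟩ ↔ (A k).Adj a b)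
    {x : Node s → ℝ} (hx : ∑ v, x v = 0) :
    energy H x - meanEnergy A p x = (∑ u, ∑ v, fluct p H u v * (x u - x v) ^ 2) / 2 := by
  have h1 : ∀ u v, adjWeight H u v * (x u - x v) ^ 2 =
      (if u.1 = v.1 then adjWeight H u v * (x u - x v) ^ 2 else 0)
      + p * ((x u - x v) ^ 2 - if u.1 = v.1 then (x u - x v) ^ 2 else 0)
      + fluct p H u v * (x u - x v) ^ 2 := by
    intro u v; unfold fluct; split_ifs <;> ring
  have h2 : ∑ k, energy (A k) (fun a => x ⟨k, a⟩)
      = (∑ u : Node s, ∑ v : Node s,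
        if u.1 = v.1 then adjWeight H u v * (x u - x v) ^ 2 else 0) / 2 := by
    rw [sum_same_cluster (fun u v => adjWeight H u v * (x u - x v) ^ 2), Finset.sum_div]
    refine Finset.sum_congr rfl fun k _ => ?_
    have e : ∀ a b, adjWeight H ⟨k, a⟩ ⟨k, b⟩ = adjWeight (A k) a b := by
      intro a b; unfold adjWeight; classical exact if_congr (hA k a b) rfl rfl
    simp only [energy, e]
  have h3 : ∑ k, ((s k : ℝ) * ∑ a, x ⟨k, a⟩ ^ 2 - (∑ a, x ⟨k, a⟩) ^ 2)
      = (∑ u : Node s, ∑ v : Node s, if u.1 = v.1 then (x u - x v) ^ 2 else 0) / 2 := by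
    rw [sum_same_cluster (fun u v => (x u - x v) ^ 2), Finset.sum_div]
    refine Finset.sum_congr rfl fun k _ => ?_
    rw [sum_sum_sub_sq (fun a => x ⟨k, a⟩), Fintype.card_fin]
  have h4 := sum_sum_sub_sq x
  rw [card_node, hx] at h4
  have h5 : ∑ v, x v ^ 2 = ∑ k, ∑ a, x ⟨k, a⟩ ^ 2 := Fintype.sum_sigma _
  have h6 : ∑ k, ((total s - s k) * ∑ a, x ⟨k, a⟩ ^ 2 + (∑ a, x ⟨k, a⟩) ^ 2)
      = total s * ∑ v, x v ^ 2
        - ∑ k, ((s k : ℝ) * ∑ a, x ⟨k, a⟩ ^ 2 - (∑ a, x ⟨k, a⟩) ^ 2) := by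
    rw [h5, Finset.mul_sum, ← Finset.sum_sub_distrib]
    exact Finset.sum_congr rfl fun k _ => by ring
  have h7 : energy H x = (∑ u : Node s, ∑ v : Node s,
        if u.1 = v.1 then adjWeight H u v * (x u - x v) ^ 2 else 0) / 2
      + p * ((∑ u, ∑ v, (x u - x v) ^ 2) / 2
        - (∑ u : Node s, ∑ v : Node s, if u.1 = v.1 then (x u - x v) ^ 2 else 0) / 2)
      + (∑ u, ∑ v, fluct p H u v * (x u - x v) ^ 2) / 2 := by
    rw [energy, Finset.sum_congr rfl fun u _ => Finset.sum_congr rfl fun v _ => h1 u v]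
    simp only [Finset.sum_add_distrib, Finset.sum_sub_distrib, ← Finset.mul_sum]
    ring
  rw [h7, meanEnergy, h6, h2, h3, h4]
  ring

/-- Expanding `(x u - x v)²` leaves a diagonal form carrying the row sums and a bilinear form in the
fluctuations; each is at most `η n ‖x‖²`. -/
theorem concentrated_of_fluct {K : ℕ} {s : Fin K → ℕ} {A : ∀ k, SimpleGraph (Fin (s k))}
    {p η δ : ℝ} (hp : p ∈ Set.Icc (0 : ℝ) 1) {H : SimpleGraph (Node s)}
    (hA : ∀ k a b, H.Adj ⟨k, a⟩ ⟨k, b⟩ ↔ (A k).Adj a b)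
    (hη : 0 ≤ η) (hδη' : δ ≤ η) (hδη : 2 * δ ^ 2 ≤ η ^ 4) (hcard : 1 ≤ δ ^ 2 * total s)
    (hrow : ∀ u, |∑ w, fluct p H u w| ≤ δ * total s)
    (hoff : ∀ u v, u ≠ v → |∑ w, fluct p H u w * fluct p H v w| ≤ δ * total s) :
    Concentrated A p (2 * η) H := by
  intro x hx
  have ht : 0 ≤ total s := by rw [← card_node]; positivity
  rw [energy_eq p hA hx]
  have h1 : (∑ u, ∑ v, fluct p H u v * (x u - x v) ^ 2) / 2
      = ∑ u, (∑ v, fluct p H u v) * x u ^ 2 - ∑ u, ∑ v, fluct p H u v * (x u * x v) := by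
    have e : ∀ u v, fluct p H u v * (x u - x v) ^ 2 = fluct p H u v * x u ^ 2
        - 2 * (fluct p H u v * (x u * x v)) + fluct p H v u * x v ^ 2 := by
      intro u v; rw [fluct_comm p H v u]; ring
    simp_rw [e]
    simp only [Finset.sum_add_distrib, Finset.sum_sub_distrib, ← Finset.mul_sum]
    rw [Finset.sum_comm (f := fun u v => fluct p H v u * x v ^ 2)]
    simp only [← Finset.sum_mul]
    ring
  have h2 : |∑ u, (∑ v, fluct p H u v) * x u ^ 2| ≤ η * total s * ∑ v, x v ^ 2 := by
    refine (Finset.abs_sum_le_sum_abs _ _).trans ?_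
    rw [Finset.mul_sum]
    refine Finset.sum_le_sum fun u _ => ?_
    rw [abs_mul, abs_of_nonneg (sq_nonneg (x u))]
    exact mul_le_mul_of_nonneg_right
      ((hrow u).trans (mul_le_mul_of_nonneg_right hδη' ht)) (sq_nonneg _)
  have h3 := abs_bilin_le (fluct p H) hη hδη (by rwa [card_node]) (abs_fluct_le hp H)
    (by rwa [card_node]) x
  rw [card_node] at h3
  rw [h1]
  refine (abs_sub _ _).trans ?_
  linarith

/-! ### Sub-Gaussian tails -/

section SubGaussian

variable {Ω : Type*} [MeasurableSpace Ω] {μ : Measure Ω}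

theorem hasSubgaussianMGF_of_abs_le_one [IsProbabilityMeasure μ] {X : Ω → ℝ}
    (hm : Measurable X) (hb : ∀ ω, |X ω| ≤ 1) (hc : ∫ ω, X ω ∂μ = 0) :
    HasSubgaussianMGF X 1 μ := by
  have h := hasSubgaussianMGF_of_mem_Icc_of_integral_eq_zero (μ := μ) (a := -1) (b := 1)
    hm.aemeasurable (ae_of_all _ fun ω => abs_le.1 (hb ω)) hc
  convert h using 1
  ext
  norm_num

theorem measure_abs_ge_le {X : Ω → ℝ} [IsProbabilityMeasure μ] {c : NNReal}
    (h : HasSubgaussianMGF X c μ) {N : ℝ} (hc : (c : ℝ) ≤ N) (hN : 0 < N) {t : ℝ} (ht : 0 ≤ t) :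
    μ {ω | t ≤ |X ω|} ≤ ENNReal.ofReal (2 * Real.exp (-t ^ 2 / (2 * N))) := by
  -- Enlarging the parameter from `c` to `N` gives all row sums and Gram entries the same tail.
  have mono : ∀ Z : Ω → ℝ, HasSubgaussianMGF Z c μ → HasSubgaussianMGF Z N.toNNReal μ :=
    fun Z hZ => ⟨hZ.integrable_exp_mul, fun s => (hZ.mgf_le s).trans <| by
      rw [Real.coe_toNNReal _ hN.le]; gcongr⟩
  have h1 := (mono _ h).measure_ge_le ht
  have h2 := (mono _ h.neg).measure_ge_le ht
  rw [Real.coe_toNNReal _ hN.le] at h1 h2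
  have hsub : {ω | t ≤ |X ω|} ⊆ {ω | t ≤ X ω} ∪ {ω | t ≤ (-X) ω} := by
    intro ω hω
    simpa [le_abs] using hω
  have h3 : μ.real {ω | t ≤ |X ω|} ≤ 2 * Real.exp (-t ^ 2 / (2 * N)) :=
    (measureReal_mono hsub).trans ((measureReal_union_le _ _).trans (by linarith))
  rw [← ofReal_measureReal]
  exact ENNReal.ofReal_le_ofReal h3

/-- Each product has two distinct independent factors, so it is centred and bounded by 1. Different
products use disjoint pairs of indices, hence are independent, and the parameters add. -/
theorem hasSubgaussianMGF_sum_mul {ι κ : Type*} {X : ι → Ω → ℝ}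
    (hind : iIndepFun X μ) (hm : ∀ i, Measurable (X i)) (hb : ∀ i ω, |X i ω| ≤ 1)
    (hc : ∀ i, ∫ ω, X i ω ∂μ = 0) {a b : κ → ι} (ha : a.Injective) (hb' : b.Injective)
    (hab : ∀ k l, a k ≠ b l) (T : Finset κ) :
    HasSubgaussianMGF (fun ω => ∑ k ∈ T, X (a k) ω * X (b k) ω) T.card μ := by
  classical
  have := hind.isProbabilityMeasure
  induction T using Finset.induction_on with
  | empty => simp
  | insert k T hk ih =>
    have hprod : HasSubgaussianMGF (fun ω => X (a k) ω * X (b k) ω) 1 μ := by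
      refine hasSubgaussianMGF_of_abs_le_one ((hm _).mul (hm _)) (fun ω => ?_) ?_
      · rw [abs_mul]
        exact mul_le_one₀ (hb _ _) (abs_nonneg _) (hb _ _)
      · rw [(hind.indepFun (hab k k)).integral_fun_mul_eq_mul_integral
          (hm _).aestronglyMeasurable (hm _).aestronglyMeasurable, hc, zero_mul]
    have hdisj : Disjoint ({a k, b k} : Finset ι) (T.image a ∪ T.image b) := by
      rw [Finset.disjoint_left]
      intro i hi hi'
      simp only [Finset.mem_insert, Finset.mem_singleton, Finset.mem_union,
        Finset.mem_image] at hi hi'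
      rcases hi with rfl | rfl <;> rcases hi' with ⟨l, hl, e⟩ | ⟨l, hl, e⟩
      · exact hk (ha e ▸ hl)
      · exact hab k l e.symm
      · exact hab l k e
      · exact hk (hb' e ▸ hl)
    have hi := hind.indepFun_finset _ _ hdisj hm
    have hi2 : IndepFun (fun ω => X (a k) ω * X (b k) ω)
        (fun ω => ∑ l ∈ T, X (a l) ω * X (b l) ω) μ := by
      have key := hi.comp
        (φ := fun f : ({a k, b k} : Finset ι) → ℝ =>
          f ⟨a k, by simp⟩ * f ⟨b k, by simp⟩)
        (ψ := fun f : (T.image a ∪ T.image b : Finset ι) → ℝ =>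
          ∑ l : T, f ⟨a l, Finset.mem_union_left _ (Finset.mem_image_of_mem _ l.2)⟩ *
            f ⟨b l, Finset.mem_union_right _ (Finset.mem_image_of_mem _ l.2)⟩)
        (by fun_prop) (by fun_prop)
      convert key using 1
      · rfl
      funext ω
      exact (Finset.sum_coe_sort T fun l => X (a l) ω * X (b l) ω).symm
    have := hprod.add_of_indepFun ih hi2
    simp only [Finset.sum_insert hk, Finset.card_insert_of_notMem hk]
    convert this using 1
    push_cast
    ring

end SubGaussian

/-! ### Tail bounds for row sums and Gram entries of the random model -/

theorem sum_eq_sum_subtype {V : Type} [Fintype V] (P : V → Prop) [DecidablePred P] (f : V → ℝ)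
    (h : ∀ v, ¬ P v → f v = 0) : ∑ v, f v = ∑ v : {v // P v}, f v := by
  rw [← Finset.sum_filter_of_ne (p := P) (s := Finset.univ)
    (fun v _ hv => by_contra fun hP => hv (h v hP))]
  exact Finset.sum_subtype _ (by simp) f

section Model

variable {Ω : Type*} {K : ℕ}
  {s : Fin K → ℕ} {A : ∀ k, SimpleGraph (Fin (s k))} {p : ℝ} {G : Ω → SimpleGraph (Node s)}

/-- The centred indicator of an edge between different clusters. -/
noncomputable def edgeVar (p : ℝ) (G : Ω → SimpleGraph (Node s)) (e : InterPair s) (ω : Ω) : ℝ :=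
  adjWeight (G ω) e.1.1 e.1.2 - p

theorem edgeVar_eq (e : InterPair s) : edgeVar p G e = (fun y : ℝ => y - p) ∘
    ({ω | (G ω).Adj e.1.1 e.1.2}.indicator fun _ => (1 : ℝ)) := by
  funext ω
  by_cases h : (G ω).Adj e.1.1 e.1.2 <;> simp [edgeVar, adjWeight, h]

theorem exists_interPair {u v : Node s} (h : u.1 ≠ v.1) :
    ∃ e : InterPair s, e.1 = (u, v) ∨ e.1 = (v, u) := by
  rcases lt_or_gt_of_ne h with h | h
  · exact ⟨⟨(v, u), h⟩, Or.inr rfl⟩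
  · exact ⟨⟨(u, v), h⟩, Or.inl rfl⟩

theorem fluct_eq_edgeVar {u v : Node s} (h : u.1 ≠ v.1) {e : InterPair s}
    (he : e.1 = (u, v) ∨ e.1 = (v, u)) (ω : Ω) : fluct p (G ω) u v = edgeVar p G e ω := by
  rw [fluct, if_neg h, edgeVar]
  rcases he with he | he <;> rw [he]
  rw [adjWeight_comm]

theorem abs_edgeVar_le (hp : p ∈ Set.Icc (0 : ℝ) 1) (e : InterPair s) (ω : Ω) :
    |edgeVar p G e ω| ≤ 1 := by
  rw [← fluct_eq_edgeVar (ne_of_gt e.2) (Or.inl rfl)]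
  exact abs_fluct_le hp _ _ _

variable [MeasurableSpace Ω] {μ : Measure Ω}

theorem IsHomogeneousRIM.measurable_edgeVar (hG : IsHomogeneousRIM μ A p G) (e : InterPair s) :
    Measurable (edgeVar p G e) := by
  rw [edgeVar_eq]
  exact (measurable_id.sub_const p).comp (measurable_const.indicator (hG.measurable e))

theorem IsHomogeneousRIM.iIndepFun_edgeVar (hG : IsHomogeneousRIM μ A p G) :
    iIndepFun (edgeVar p G) μ := by
  have h := (hG.indep.iIndepFun_indicator (β := ℝ)).comp (fun _ y => y - p)
    (fun _ => measurable_id.sub_const p)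
  convert h using 1
  funext e
  exact edgeVar_eq e

variable [IsProbabilityMeasure μ]

theorem IsHomogeneousRIM.integral_edgeVar (hG : IsHomogeneousRIM μ A p G)
    (hp : p ∈ Set.Icc (0 : ℝ) 1) (e : InterPair s) : ∫ ω, edgeVar p G e ω ∂μ = 0 := by
  rw [edgeVar_eq]
  simp only [Function.comp_apply]
  rw [integral_sub ((integrable_const _).indicator (hG.measurable e)) (integrable_const _),
    integral_indicator_const _ (hG.measurable e), measureReal_def, hG.prob e,
    ENNReal.toReal_ofReal hp.1]
  simp

theorem IsHomogeneousRIM.hasSubgaussianMGF_row (hG : IsHomogeneousRIM μ A p G)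
    (hp : p ∈ Set.Icc (0 : ℝ) 1) (u : Node s) :
    ∃ c : NNReal, (c : ℝ) ≤ total s ∧
      HasSubgaussianMGF (fun ω => ∑ w, fluct p (G ω) u w) c μ := by
  choose e he using fun w : {w : Node s // u.1 ≠ w.1} => exists_interPair w.2
  -- An edge at `u` determines its other endpoint, so a row uses each independent variable once.
  have hinj : Function.Injective e := by
    intro w w' h
    have h1 := he w
    have h2 := he w'
    rw [h] at h1
    have := w.2
    have := w'.2
    ext1
    rcases h1 with h1 | h1 <;> rcases h2 with h2 | h2 <;>
      (rw [h1, Prod.mk.injEq] at h2; grind)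
  have h := HasSubgaussianMGF.sum_of_iIndepFun (hG.iIndepFun_edgeVar.precomp hinj)
    (c := fun _ => 1) (s := Finset.univ) fun w _ => hasSubgaussianMGF_of_abs_le_one
      (hG.measurable_edgeVar _) (abs_edgeVar_le hp _) (hG.integral_edgeVar hp _)
  refine ⟨_, ?_, h.congr (ae_of_all _ fun ω => ?_)⟩
  · simp only [Finset.sum_const, nsmul_eq_mul, mul_one, NNReal.coe_natCast, Finset.card_univ,
      ← card_node]
    exact_mod_cast Fintype.card_subtype_le _
  · simp only
    rw [sum_eq_sum_subtype (fun w : Node s => u.1 ≠ w.1)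
      _ (fun w hw => by rw [fluct, if_pos (not_not.1 hw)])]
    exact Finset.sum_congr rfl fun w _ => (fluct_eq_edgeVar w.2 (he w) ω).symm

theorem IsHomogeneousRIM.hasSubgaussianMGF_gram (hG : IsHomogeneousRIM μ A p G)
    (hp : p ∈ Set.Icc (0 : ℝ) 1) {u v : Node s} (huv : u ≠ v) :
    ∃ c : NNReal, (c : ℝ) ≤ total s ∧
      HasSubgaussianMGF (fun ω => ∑ w, fluct p (G ω) u w * fluct p (G ω) v w) c μ := by
  choose a ha using fun w : {w : Node s // u.1 ≠ w.1 ∧ v.1 ≠ w.1} => exists_interPair w.2.1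
  choose b hb using fun w : {w : Node s // u.1 ≠ w.1 ∧ v.1 ≠ w.1} => exists_interPair w.2.2
  have hainj : Function.Injective a := by
    intro w w' h
    have h1 := ha w
    have h2 := ha w'
    rw [h] at h1
    have := w.2
    have := w'.2
    ext1
    rcases h1 with h1 | h1 <;> rcases h2 with h2 | h2 <;>
      (rw [h1, Prod.mk.injEq] at h2; grind)
  have hbinj : Function.Injective b := by
    intro w w' h
    have h1 := hb w
    have h2 := hb w'
    rw [h] at h1
    have := w.2
    have := w'.2
    ext1
    rcases h1 with h1 | h1 <;> rcases h2 with h2 | h2 <;>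
      (rw [h1, Prod.mk.injEq] at h2; grind)
  -- If `{u, w} = {v, w'}` with `u ≠ v`, then `w = v`, which is impossible because `w` lies outside
  -- the cluster of `v`.
  have hab : ∀ w w', a w ≠ b w' := by
    intro w w' h
    have h1 := ha w
    have h2 := hb w'
    rw [h] at h1
    have := w.2
    have := w'.2
    rcases h1 with h1 | h1 <;> rcases h2 with h2 | h2 <;>
      (rw [h1, Prod.mk.injEq] at h2; grind)
  have h := hasSubgaussianMGF_sum_mul hG.iIndepFun_edgeVar hG.measurable_edgeVar
    (abs_edgeVar_le hp) (hG.integral_edgeVar hp) hainj hbinj hab Finset.univ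
  refine ⟨_, ?_, h.congr (ae_of_all _ fun ω => ?_)⟩
  · rw [NNReal.coe_natCast, Finset.card_univ, ← card_node]
    exact_mod_cast Fintype.card_subtype_le _
  · simp only
    rw [sum_eq_sum_subtype (fun w : Node s => u.1 ≠ w.1 ∧ v.1 ≠ w.1)]
    · exact Finset.sum_congr rfl fun w _ => by
        rw [fluct_eq_edgeVar w.2.1 (ha w) ω, fluct_eq_edgeVar w.2.2 (hb w) ω]
    · intro w hw
      rw [not_and_or, not_not, not_not] at hw
      rcases hw with hw | hw
      · rw [fluct, if_pos hw, zero_mul]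
      · rw [fluct, fluct, if_pos hw, mul_zero]

/-- The event that some row sum or off-diagonal Gram entry of the fluctuations is large. -/
def badEvent (p δ : ℝ) (G : Ω → SimpleGraph (Node s)) : Set Ω :=
  ⋃ e : Node s × Node s, {ω | δ * total s ≤ |∑ w, fluct p (G ω) e.1 w|} ∪
    {ω | e.1 ≠ e.2 ∧ δ * total s ≤ |∑ w, fluct p (G ω) e.1 w * fluct p (G ω) e.2 w|}

/-- Union bound over the `n²` pairs of nodes; the factor 4 counts two two-sided tails. The row event
of a node is repeated for each partner, which only weakens the bound. -/
theorem IsHomogeneousRIM.measure_badEvent_le (hG : IsHomogeneousRIM μ A p G)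
    (hp : p ∈ Set.Icc (0 : ℝ) 1) {δ : ℝ} (hδ : 0 ≤ δ) :
    μ (badEvent p δ G) ≤
      ENNReal.ofReal (4 * (total s ^ 2 * Real.exp (-(δ ^ 2 / 2) * total s))) := by
  have key : ∀ e : Node s × Node s, μ ({ω | δ * total s ≤ |∑ w, fluct p (G ω) e.1 w|} ∪
      {ω | e.1 ≠ e.2 ∧ δ * total s ≤ |∑ w, fluct p (G ω) e.1 w * fluct p (G ω) e.2 w|})
      ≤ ENNReal.ofReal (4 * Real.exp (-(δ ^ 2 / 2) * total s)) := by
    intro e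
    have hN : 0 < total s := by
      rw [← card_node]
      exact_mod_cast Fintype.card_pos_iff.2 ⟨e.1⟩
    have hexp : -(δ * total s) ^ 2 / (2 * total s) = -(δ ^ 2 / 2) * total s := by
      field_simp
    obtain ⟨c, hc, h⟩ := hG.hasSubgaussianMGF_row hp e.1
    have h1 := measure_abs_ge_le h hc hN (mul_nonneg hδ hN.le)
    have h2 : μ {ω | e.1 ≠ e.2 ∧
        δ * total s ≤ |∑ w, fluct p (G ω) e.1 w * fluct p (G ω) e.2 w|}
        ≤ ENNReal.ofReal (2 * Real.exp (-(δ * total s) ^ 2 / (2 * total s))) := by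
      by_cases he : e.1 = e.2
      · simp [he]
      · obtain ⟨c, hc, h⟩ := hG.hasSubgaussianMGF_gram hp he
        simpa [he] using measure_abs_ge_le h hc hN (mul_nonneg hδ hN.le)
    rw [hexp] at h1 h2
    refine (measure_union_le _ _).trans ((add_le_add h1 h2).trans (le_of_eq ?_))
    rw [← ENNReal.ofReal_add (by positivity) (by positivity)]
    congr 1; ring
  refine (measure_iUnion_fintype_le _ _).trans ((Finset.sum_le_sum fun e _ => key e).trans
    (le_of_eq ?_))
  rw [Finset.sum_const, nsmul_eq_mul, Finset.card_univ, Fintype.card_prod,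
    ← ENNReal.ofReal_natCast, ← ENNReal.ofReal_mul (Nat.cast_nonneg _), Nat.cast_mul, card_node]
  congr 1; ring

end Model

/-! ### Almost sure concentration by Borel–Cantelli -/

theorem IsGrowing.le_total {K : ℕ} {size : ℕ → Fin K → ℕ} {c : ℝ} (h : IsGrowing size c) (m : ℕ) :
    (m : ℝ) ≤ total (size m) := by
  have : m ≤ ∑ k, size m k := h.strictMono.id_le m
  unfold total
  exact_mod_cast this

theorem ae_eventually_concentrated_of_pos {Ω : Type*} [MeasurableSpace Ω] {μ : Measure Ω}
    [IsProbabilityMeasure μ] {K : ℕ} {size : ℕ → Fin K → ℕ} {c : ℝ} (hgrow : IsGrowing size c)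
    {A : ∀ m k, SimpleGraph (Fin (size m k))} {p : ℝ} (hp : p ∈ Set.Icc (0 : ℝ) 1)
    {G : (m : ℕ) → Ω → SimpleGraph (Node (size m))}
    (hG : ∀ m, IsHomogeneousRIM μ (A m) p (G m)) {η : ℝ} (hη : 0 < η) :
    ∀ᵐ ω ∂μ, ∀ᶠ m in atTop, Concentrated (A m) p (2 * η) (G m ω) := by
  -- The second argument gives `δ² ≤ η⁴ / 4`, more than `concentrated_of_fluct` needs.
  set δ := min η (η ^ 2 / 2) with hδdef
  have hδ : 0 < δ := lt_min hη (by positivity)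
  have hsum : Summable fun m : ℕ =>
      4 * (total (size m) ^ 2 * Real.exp (-(δ ^ 2 / 2) * total (size m))) := by
    -- Total sizes are distinct natural numbers, so the series is a subseries of `∑ N² exp(-aN)`.
    have h := (Real.summable_pow_mul_exp_neg_nat_mul 2
      (show 0 < δ ^ 2 / 2 by positivity)).comp_injective hgrow.strictMono.injective
    exact (h.mul_left 4).congr fun m => by simp [total]
  have hfin : ∑' m, μ (badEvent p δ (G m)) ≠ ⊤ :=
    ne_top_of_le_ne_top hsum.tsum_ofReal_ne_top
      (ENNReal.tsum_le_tsum fun m => (hG m).measure_badEvent_le hp hδ.le)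
  filter_upwards [ae_eventually_notMem hfin] with ω hω
  have hlarge : ∀ᶠ m : ℕ in atTop, 1 ≤ δ ^ 2 * total (size m) := by
    obtain ⟨M, hM⟩ := exists_nat_ge (1 / δ ^ 2)
    filter_upwards [eventually_ge_atTop M] with m hm
    have h1 : (1 : ℝ) / δ ^ 2 ≤ total (size m) :=
      hM.trans ((Nat.cast_le.2 hm).trans (hgrow.le_total m))
    rwa [div_le_iff₀' (by positivity)] at h1
  filter_upwards [hω, hlarge] with m hm hl
  simp only [badEvent, Set.mem_iUnion, not_exists, Set.mem_union, not_or, Set.mem_ofPred_eq,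
    not_and, not_le] at hm
  refine concentrated_of_fluct hp ((hG m).internal ω) hη.le (min_le_left _ _) ?_ hl
    (fun u => ((hm (u, u)).1).le) (fun u v huv => ((hm (u, v)).2 huv).le)
  have h1 : δ ≤ η ^ 2 / 2 := min_le_right _ _
  have h2 : δ ^ 2 ≤ (η ^ 2 / 2) ^ 2 := pow_le_pow_left₀ hδ.le h1 2
  nlinarith [pow_pos hη 4]

theorem Concentrated.mono {K : ℕ} {s : Fin K → ℕ} {A : ∀ k, SimpleGraph (Fin (s k))} {p δ δ' : ℝ}
    {H : SimpleGraph (Node s)} (h : Concentrated A p δ H) (hδ : δ ≤ δ') :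
    Concentrated A p δ' H := by
  intro x hx
  refine (h x hx).trans ?_
  have : 0 ≤ total s := by rw [← card_node]; positivity
  have : 0 ≤ ∑ v, x v ^ 2 := Finset.sum_nonneg fun v _ => sq_nonneg _
  gcongr

/-- Almost surely, the random Laplacians divided by the number of nodes approach their means. -/
theorem ae_eventually_concentrated {Ω : Type*} [MeasurableSpace Ω] {μ : Measure Ω}
    [IsProbabilityMeasure μ] {K : ℕ} {size : ℕ → Fin K → ℕ} {c : ℝ} (hgrow : IsGrowing size c)
    {A : ∀ m k, SimpleGraph (Fin (size m k))} {p : ℝ} (hp : p ∈ Set.Icc (0 : ℝ) 1)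
    {G : (m : ℕ) → Ω → SimpleGraph (Node (size m))}
    (hG : ∀ m, IsHomogeneousRIM μ (A m) p (G m)) :
    ∀ᵐ ω ∂μ, ∀ ε > 0, ∀ᶠ m in atTop, Concentrated (A m) p ε (G m ω) := by
  -- Countably many tolerances suffice, so a single null set serves every `ε`.
  have h : ∀ᵐ ω ∂μ, ∀ i : ℕ, ∀ᶠ m in atTop,
      Concentrated (A m) p (2 * (1 / ((i : ℝ) + 1))) (G m ω) :=
    ae_all_iff.2 fun i => ae_eventually_concentrated_of_pos hgrow hp hG (by positivity)
  filter_upwards [h] with ω hω ε hε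
  obtain ⟨i, hi⟩ := exists_nat_one_div_lt (show 0 < ε / 2 by positivity)
  filter_upwards [hω i] with m hm
  exact hm.mono (by linarith)

/-! ### Test matrices for the mean Laplacian -/

theorem exists_orthonormal_orthogonal {V : Type} [Fintype V] {r f : ℕ} (F : Fin f → V → ℝ)
    (h : r + f ≤ Fintype.card V) :
    ∃ Z : V → Fin r → ℝ, (∀ i j, ∑ v, Z v i * Z v j = if i = j then 1 else 0) ∧
      ∀ i j, ∑ v, F i v * Z v j = 0 := by
  classical
  let S : Submodule ℝ (EuclideanSpace ℝ V) :=
    Submodule.span ℝ (Set.range fun i => WithLp.toLp 2 (F i))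
  have h1 : Module.finrank ℝ S ≤ f := by
    exact (finrank_range_le_card (R := ℝ) (fun i => WithLp.toLp 2 (F i))).trans (by simp)
  have h2 := S.finrank_add_finrank_orthogonal
  rw [finrank_euclideanSpace] at h2
  have h3 : r ≤ Module.finrank ℝ Sᗮ := by omega
  let b := stdOrthonormalBasis ℝ Sᗮ
  refine ⟨fun v i => (b (Fin.castLE h3 i) : EuclideanSpace ℝ V) v, fun i j => ?_, fun i j => ?_⟩
  · have := orthonormal_iff_ite.1 b.orthonormal (Fin.castLE h3 j) (Fin.castLE h3 i)
    rw [Submodule.coe_inner, PiLp.inner_apply] at this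
    simpa [eq_comm] using this
  · have := (Submodule.mem_orthogonal S _).1 (b (Fin.castLE h3 j)).2 _
      (Submodule.subset_span ⟨i, rfl⟩)
    rw [PiLp.inner_apply] at this
    simpa [mul_comm] using this

theorem feasible_nonempty {V : Type} [Fintype V] {K : ℕ} (hK : 1 ≤ K) (h : K ≤ Fintype.card V) :
    (feasible V K).Nonempty := by
  obtain ⟨Z, hZ, hZ'⟩ := exists_orthonormal_orthogonal (V := V) (r := K - 1)
    (fun (_ : Fin 1) _ => (1 : ℝ)) (by omega)
  exact ⟨Z, (feasible_iff Z).2 ⟨hZ, fun j => by simpa using hZ' 0 j⟩⟩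

section Deterministic

variable {K : ℕ} {s : Fin K → ℕ} {A : ∀ k, SimpleGraph (Fin (s k))} {p δ : ℝ}
  {H : SimpleGraph (Node s)}

theorem total_nonneg (s : Fin K → ℕ) : 0 ≤ total s := by rw [← card_node]; positivity

theorem le_nmax (s : Fin K → ℕ) (k : Fin K) : (s k : ℝ) ≤ nmax s :=
  le_ciSup (f := fun k => (s k : ℝ)) (Set.finite_range _).bddAbove k

theorem nmin_le (s : Fin K → ℕ) (k : Fin K) : nmin s ≤ (s k : ℝ) :=
  ciInf_le (f := fun k => (s k : ℝ)) (Set.finite_range _).bddBelow k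

theorem exists_eq_nmax [Nonempty (Fin K)] (s : Fin K → ℕ) : ∃ k, (s k : ℝ) = nmax s :=
  exists_eq_ciSup_of_finite (f := fun k => (s k : ℝ))

theorem nmin_le_nmax [Nonempty (Fin K)] (s : Fin K → ℕ) : nmin s ≤ nmax s :=
  (nmin_le s (Classical.arbitrary _)).trans (le_nmax s _)

theorem nmax_nonneg (s : Fin K → ℕ) : 0 ≤ nmax s :=
  Real.iSup_nonneg fun _ => Nat.cast_nonneg _

theorem total_le_mul_nmax (s : Fin K → ℕ) : total s ≤ K * nmax s := by
  calc total s ≤ ∑ _k : Fin K, nmax s := Finset.sum_le_sum fun k _ => le_nmax s k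
    _ = K * nmax s := by simp

theorem natCast_pred (hK : 1 ≤ K) : ((K - 1 : ℕ) : ℝ) = (K : ℝ) - 1 := by
  push_cast [hK]; ring

/-- Weighted cluster-constant vectors form a solution candidate on which the mean Laplacian takes
the value `p n`. -/
theorem exists_feasible_clusterConstant (hK : 1 ≤ K) (hs : ∀ k, 0 < s k)
    (A : ∀ k, SimpleGraph (Fin (s k))) (p : ℝ) :
    ∃ X ∈ feasible (Node s) K, ∀ j, meanEnergy A p (fun v => X v j) = p * total s := by
  -- Orthogonality to `(√sₖ)` becomes the sum-zero condition once row `k` of `Z` is divided by `√sₖ`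
  -- and repeated over cluster `k`.
  obtain ⟨Z, hZ, hZ'⟩ := exists_orthonormal_orthogonal (V := Fin K) (r := K - 1)
    (fun (_ : Fin 1) k => √(s k : ℝ)) (by simp; omega)
  have hs' : ∀ k, (0 : ℝ) < s k := fun k => Nat.cast_pos.2 (hs k)
  have hsq : ∀ k, √(s k : ℝ) * √(s k : ℝ) = s k := fun k => Real.mul_self_sqrt (hs' k).le
  have hpos : ∀ k, 0 < √(s k : ℝ) := fun k => Real.sqrt_pos.2 (hs' k)
  have hmul : ∀ k (x y : ℝ), (s k : ℝ) * (x / √(s k : ℝ) * (y / √(s k : ℝ))) = x * y := by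
    intro k x y
    have := (hpos k).ne'
    field_simp
    rw [Real.sq_sqrt (hs' k).le]
    ring
  have hsum : ∀ k (x : ℝ), (s k : ℝ) * (x / √(s k : ℝ)) = √(s k : ℝ) * x := by
    intro k x
    have := (hpos k).ne'
    calc (s k : ℝ) * (x / √(s k : ℝ)) = √(s k : ℝ) * √(s k : ℝ) * (x / √(s k : ℝ)) := by
          rw [hsq]
      _ = √(s k : ℝ) * x := by field_simp
  refine ⟨fun v j => Z v.1 j / √(s v.1 : ℝ), (feasible_iff _).2 ⟨fun i j => ?_, fun j => ?_⟩,
    fun j => ?_⟩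
  · rw [Fintype.sum_sigma, ← hZ i j]
    exact Finset.sum_congr rfl fun k _ => by simp [hmul]
  · rw [Fintype.sum_sigma, ← hZ' 0 j]
    exact Finset.sum_congr rfl fun k _ => by simp [hsum]
  · have h1 : ∀ k, (total s - s k) * ∑ _a : Fin (s k), (Z k j / √(s k : ℝ)) ^ 2
        + (∑ _a : Fin (s k), Z k j / √(s k : ℝ)) ^ 2 = total s * (Z k j * Z k j) := by
      intro k
      simp only [Finset.sum_const, Finset.card_univ, Fintype.card_fin, nsmul_eq_mul, sq, hmul, hsum]
      linear_combination (Z k j * Z k j) * hsq k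
    have h2 : ∑ k, Z k j * Z k j = 1 := by simpa using hZ j j
    simp only [meanEnergy, h1, ← Finset.mul_sum, h2]
    simp [energy]

/-- Extension by zero of a function on one cluster. -/
noncomputable def extendCluster (k₀ : Fin K) (z : Fin (s k₀) → ℝ) (v : Node s) : ℝ :=
  if h : v.1 = k₀ then z (h ▸ v.2) else 0

theorem extendCluster_self (k₀ : Fin K) (z : Fin (s k₀) → ℝ) (a : Fin (s k₀)) :
    extendCluster k₀ z ⟨k₀, a⟩ = z a := by
  simp [extendCluster]

theorem extendCluster_of_ne {k k₀ : Fin K} (h : k ≠ k₀) (z : Fin (s k₀) → ℝ) (a : Fin (s k)) :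
    extendCluster k₀ z ⟨k, a⟩ = 0 := by
  simp [extendCluster, h]

/-- `K - 1` columns and two linear constraints, sum zero and value zero at the hub, account for `K +
1` dimensions. -/
theorem exists_feasible_star {n : ℕ} (hK : 1 ≤ K) (hn : K + 1 ≤ n) (r : Fin n) :
    ∃ Z ∈ feasible (Fin n) K, ∀ j, Z r j = 0 := by
  obtain ⟨Z, hZ, hZ'⟩ := exists_orthonormal_orthogonal (V := Fin n) (r := K - 1)
    (![fun _ => (1 : ℝ), Pi.single r 1] : Fin 2 → Fin n → ℝ) (by simp; omega)
  refine ⟨Z, (feasible_iff Z).2 ⟨hZ, fun j => by simpa using hZ' 0 j⟩, fun j => ?_⟩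
  simpa [Pi.single_apply] using hZ' 1 j

/-- All columns live on one star and sum to zero there, so the squared cluster sums vanish. For `p >
0` the largest cluster is the cheapest choice. -/
theorem exists_feasible_singleCluster (hK : 1 ≤ K) (k₀ : Fin K) (hk : K + 1 ≤ s k₀)
    {r : Fin (s k₀)} (hA : A k₀ = SimpleGraph.starGraph r) (p : ℝ) :
    ∃ X ∈ feasible (Node s) K, ∀ j,
      meanEnergy A p (fun v => X v j) = 1 + p * (total s - s k₀) := by
  obtain ⟨Z, hZ, hr⟩ := exists_feasible_star hK hk r
  have hZ1 := ((feasible_iff Z).1 hZ).1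
  refine ⟨fun v j => extendCluster k₀ (fun a => Z a j) v,
    (feasible_iff _).2 ⟨fun i j => ?_, fun j => ?_⟩, fun j => ?_⟩
  · rw [Fintype.sum_sigma, Finset.sum_eq_single k₀ (fun k _ hk => by
      simp [extendCluster_of_ne hk]) (by simp), ← hZ1 i j]
    simp [extendCluster_self]
  · rw [Fintype.sum_sigma, Finset.sum_eq_single k₀ (fun k _ hk => by
      simp [extendCluster_of_ne hk]) (by simp), ← feasible.sum_eq_zero hZ j]
    simp [extendCluster_self]
  · rw [meanEnergy, Finset.sum_eq_single k₀ (fun k _ hk => by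
      simp [extendCluster_of_ne hk, energy]) (by simp),
      Finset.sum_eq_single k₀ (fun k _ hk => by simp [extendCluster_of_ne hk]) (by simp)]
    simp only [extendCluster_self, feasible.sum_eq_zero hZ j, feasible.sum_sq hZ j]
    rw [hA, energy_starGraph r _ (hr j), feasible.sum_sq hZ j]
    ring

/-! ### From the mean form to the random graph, for complete and star clusters -/

theorem Concentrated.abs_sum_sub_le (h : Concentrated A p δ H) (hK : 1 ≤ K)
    {X : Matrix (Node s) (Fin (K - 1)) ℝ} (hX : X ∈ feasible (Node s) K) :
    |∑ j, energy H (fun v => X v j) - ∑ j, meanEnergy A p (fun v => X v j)|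
      ≤ ((K : ℝ) - 1) * (δ * total s) := by
  rw [← Finset.sum_sub_distrib]
  refine (Finset.abs_sum_le_sum_abs _ _).trans ?_
  calc _ ≤ ∑ _j : Fin (K - 1), δ * total s := Finset.sum_le_sum fun j _ => by
        have := h _ (feasible.sum_eq_zero hX j)
        rwa [feasible.sum_sq hX j, mul_one] at this
    _ = _ := by simp [natCast_pred hK]

theorem Concentrated.exists_energy_le (h : Concentrated A p δ H) (hK : 1 ≤ K) {b : ℝ}
    (hX : ∃ X ∈ feasible (Node s) K, ∀ j, meanEnergy A p (fun v => X v j) = b) :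
    ∃ X ∈ feasible (Node s) K,
      ∑ j, energy H (fun v => X v j) ≤ ((K : ℝ) - 1) * (b + δ * total s) := by
  obtain ⟨X, hX, hb⟩ := hX
  refine ⟨X, hX, ?_⟩
  have h1 := (abs_le.1 (h.abs_sum_sub_le hK hX)).2
  simp only [hb, Finset.sum_const, Finset.card_univ, Fintype.card_fin, nsmul_eq_mul,
    natCast_pred hK] at h1
  linarith

theorem Concentrated.partialEigSum_le (h : Concentrated A p δ H) (hK : 1 ≤ K) {b : ℝ}
    (hX : ∃ X ∈ feasible (Node s) K, ∀ j, meanEnergy A p (fun v => X v j) = b) :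
    partialEigSum K (laplacian H) ≤ ((K : ℝ) - 1) * (b + δ * total s) := by
  obtain ⟨X, hX, hb⟩ := h.exists_energy_le hK hX
  exact (RIM.partialEigSum_le H hX).trans hb

/-- The error is paid twice: for the competitor, and for passing back from `H` to the mean at `Y`.
-/
theorem Concentrated.sum_meanEnergy_le (h : Concentrated A p δ H) (hK : 1 ≤ K) {b : ℝ}
    (hX : ∃ X ∈ feasible (Node s) K, ∀ j, meanEnergy A p (fun v => X v j) = b)
    {Y : Matrix (Node s) (Fin (K - 1)) ℝ} (hY : IsSpectralSolution (laplacian H) Y) :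
    ∑ j, meanEnergy A p (fun v => Y v j) ≤ ((K : ℝ) - 1) * (b + 2 * (δ * total s)) := by
  obtain ⟨X, hX, hb⟩ := h.exists_energy_le hK hX
  have h1 := (abs_le.1 (h.abs_sum_sub_le hK hY.1)).1
  have h2 := hY.energy_le hX
  linarith

theorem Concentrated.le_partialEigSum (h : Concentrated A p δ H) (hK : 1 ≤ K) {b : ℝ}
    (hne : (feasible (Node s) K).Nonempty)
    (hb : ∀ X ∈ feasible (Node s) K, ∀ j, b ≤ meanEnergy A p (fun v => X v j)) :
    ((K : ℝ) - 1) * (b - δ * total s) ≤ partialEigSum K (laplacian H) := by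
  refine RIM.le_partialEigSum H hne fun X hX => ?_
  have h1 := (abs_le.1 (h.abs_sum_sub_le hK hX)).1
  have h2 : ((K : ℝ) - 1) * b ≤ ∑ j, meanEnergy A p (fun v => X v j) := by
    calc ((K : ℝ) - 1) * b = ∑ _j : Fin (K - 1), b := by simp [natCast_pred hK]
      _ ≤ _ := Finset.sum_le_sum fun j _ => hb X hX j
  linarith

theorem sq_sum_cluster_le (x : Node s → ℝ) (k : Fin K) :
    (∑ a, x ⟨k, a⟩) ^ 2 ≤ s k * ∑ a, x ⟨k, a⟩ ^ 2 := by
  simpa using sq_sum_le_card_mul_sum_sq (s := Finset.univ) (f := fun a : Fin (s k) => x ⟨k, a⟩)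

/-- A complete cluster's energy is its within-cluster deviation, the very term missing from the
interconnection part. This isolates a nonnegative excess over `p n ‖x‖²`. -/
theorem meanEnergy_complete (hA : ∀ k, A k = ⊤) (x : Node s → ℝ) :
    meanEnergy A p x = p * total s * ∑ v, x v ^ 2
      + (1 - p) * ∑ k, (s k * ∑ a, x ⟨k, a⟩ ^ 2 - (∑ a, x ⟨k, a⟩) ^ 2) := by
  have h5 : ∑ v, x v ^ 2 = ∑ k, ∑ a, x ⟨k, a⟩ ^ 2 := Fintype.sum_sigma _
  simp only [meanEnergy, hA, energy_top, Fintype.card_fin, h5, Finset.mul_sum,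
    ← Finset.sum_add_distrib]
  refine Finset.sum_congr rfl fun k _ => ?_
  simp only [← Finset.mul_sum]
  ring

/-- The squared cluster sums are kept because they later force the incoherence of minimizers for
stars. -/
theorem le_meanEnergy (hp : 0 ≤ p) (x : Node s → ℝ) :
    p * (total s - nmax s) * ∑ v, x v ^ 2 + p * ∑ k, (∑ a, x ⟨k, a⟩) ^ 2 ≤ meanEnergy A p x := by
  have h5 : ∑ v, x v ^ 2 = ∑ k, ∑ a, x ⟨k, a⟩ ^ 2 := Fintype.sum_sigma _
  have h1 : 0 ≤ ∑ k, energy (A k) (fun a => x ⟨k, a⟩) :=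
    Finset.sum_nonneg fun k _ => energy_nonneg _ _
  have h2 : (total s - nmax s) * ∑ v, x v ^ 2 + ∑ k, (∑ a, x ⟨k, a⟩) ^ 2
      ≤ ∑ k, ((total s - s k) * ∑ a, x ⟨k, a⟩ ^ 2 + (∑ a, x ⟨k, a⟩) ^ 2) := by
    rw [h5, Finset.mul_sum, ← Finset.sum_add_distrib]
    refine Finset.sum_le_sum fun k _ => ?_
    have : 0 ≤ ∑ a, x ⟨k, a⟩ ^ 2 := Finset.sum_nonneg fun a _ => sq_nonneg _
    have := le_nmax s k
    gcongr
  have := mul_le_mul_of_nonneg_left h2 hp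
  rw [meanEnergy]
  linarith

theorem feasible_node_nonempty (hK : 1 ≤ K) (hs : ∀ k, 0 < s k) :
    (feasible (Node s) K).Nonempty := by
  refine feasible_nonempty hK ?_
  rw [Fintype.card_sigma]
  simpa using Finset.card_nsmul_le_sum (Finset.univ : Finset (Fin K)) s 1 fun k _ => hs k

theorem cStar_nonneg (A : ∀ k, SimpleGraph (Fin (s k))) : 0 ≤ cStar A :=
  div_nonneg (Real.iInf_nonneg fun _ => partialEigSum_nonneg _ _) (total_nonneg s)

theorem le_cStar_complete (hK : 2 ≤ K) (hs : ∀ k, K ≤ s k) (hA : ∀ k, A k = ⊤) :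
    ((K : ℝ) - 1) * (nmin s / total s) ≤ cStar A := by
  have : Nonempty (Fin K) := ⟨⟨0, by omega⟩⟩
  rw [← mul_div_assoc]
  refine div_le_div_of_nonneg_right (le_ciInf fun k => ?_) (total_nonneg s)
  refine le_partialEigSum _ (feasible_nonempty (by omega) (by simpa using hs k)) fun X hX => ?_
  have hR : (0 : ℝ) ≤ (K : ℝ) - 1 := by
    rw [← natCast_pred (by omega : 1 ≤ K)]; positivity
  simp only [hA, energy_top, feasible.sum_sq hX, feasible.sum_eq_zero hX, Fintype.card_fin]
  simpa [natCast_pred (by omega : 1 ≤ K)] using mul_le_mul_of_nonneg_left (nmin_le s k) hR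

theorem cStar_star_le (hK : 2 ≤ K) (hs : ∀ k, K + 1 ≤ s k)
    (hA : ∀ k, ∃ r, A k = SimpleGraph.starGraph r) : cStar A ≤ ((K : ℝ) - 1) / total s := by
  have k₀ : Fin K := ⟨0, by omega⟩
  refine div_le_div_of_nonneg_right ((ciInf_le (Set.finite_range _).bddBelow k₀).trans ?_)
    (total_nonneg s)
  obtain ⟨r, hr⟩ := hA k₀
  obtain ⟨Z, hZ, hZr⟩ := exists_feasible_star (by omega) (hs k₀) r
  refine (partialEigSum_le _ hZ).trans (le_of_eq ?_)
  have e : ∀ j, energy (A k₀) (fun v => Z v j) = 1 := fun j => by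
    rw [hr, energy_starGraph r _ (hZr j), feasible.sum_sq hZ j]
  simp [e, natCast_pred (by omega : 1 ≤ K)]

theorem partialEigSum_complete_bounds (hK : 1 ≤ K) (hs : ∀ k, 0 < s k) (hA : ∀ k, A k = ⊤)
    (hp : p ≤ 1) (h : Concentrated A p δ H) :
    ((K : ℝ) - 1) * (p * total s - δ * total s) ≤ partialEigSum K (laplacian H) ∧
      partialEigSum K (laplacian H) ≤ ((K : ℝ) - 1) * (p * total s + δ * total s) := by
  refine ⟨h.le_partialEigSum hK (feasible_node_nonempty hK hs) fun X hX j => ?_,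
    h.partialEigSum_le hK (exists_feasible_clusterConstant hK hs A p)⟩
  rw [meanEnergy_complete hA, feasible.sum_sq hX, mul_one, le_add_iff_nonneg_right]
  exact mul_nonneg (by linarith) (Finset.sum_nonneg fun k _ =>
    sub_nonneg.2 (sq_sum_cluster_le (fun v => X v j) k))

theorem partialEigSum_star_bounds (hK : 2 ≤ K) (hs : ∀ k, K + 1 ≤ s k)
    (hA : ∀ k, ∃ r, A k = SimpleGraph.starGraph r) (hp : 0 ≤ p) (h : Concentrated A p δ H) :
    ((K : ℝ) - 1) * (p * (total s - nmax s) - δ * total s) ≤ partialEigSum K (laplacian H) ∧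
      partialEigSum K (laplacian H)
        ≤ ((K : ℝ) - 1) * (1 + p * (total s - nmax s) + δ * total s) := by
  have : Nonempty (Fin K) := ⟨⟨0, by omega⟩⟩
  obtain ⟨k₀, hk⟩ := exists_eq_nmax s
  obtain ⟨r, hr⟩ := hA k₀
  refine ⟨h.le_partialEigSum (by omega) (feasible_node_nonempty (by omega)
    fun k => (by have := hs k; omega)) fun X hX j => ?_, ?_⟩
  · have h1 := le_meanEnergy (A := A) hp (fun v => X v j)
    rw [feasible.sum_sq hX, mul_one] at h1
    have : 0 ≤ p * ∑ k, (∑ a, X ⟨k, a⟩ j) ^ 2 :=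
      mul_nonneg hp (Finset.sum_nonneg fun k _ => sq_nonneg _)
    linarith
  · rw [← hk]
    exact h.partialEigSum_le (by omega) (exists_feasible_singleCluster (by omega) k₀ (hs k₀) hr p)

/-- The mean energy of `Y` exceeds the optimum `(K - 1) p n` by at most the concentration error, and
this excess is a sum of nonnegative deviations. -/
theorem IsSpectralSolution.cluster_deviation_le (hK : 1 ≤ K) (hs : ∀ k, 0 < s k)
    (hA : ∀ k, A k = ⊤) (hp : p ≤ 1) (h : Concentrated A p δ H)
    {Y : Matrix (Node s) (Fin (K - 1)) ℝ} (hY : IsSpectralSolution (laplacian H) Y) (k : Fin K) :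
    (1 - p) * ∑ j, (s k * ∑ a, Y ⟨k, a⟩ j ^ 2 - (∑ a, Y ⟨k, a⟩ j) ^ 2)
      ≤ ((K : ℝ) - 1) * (2 * (δ * total s)) := by
  have h1 := h.sum_meanEnergy_le hK (exists_feasible_clusterConstant hK hs A p) hY
  simp only [meanEnergy_complete hA, feasible.sum_sq hY.1, mul_one, Finset.sum_add_distrib,
    ← Finset.mul_sum] at h1
  simp only [Finset.sum_const, Finset.card_univ, Fintype.card_fin, nsmul_eq_mul,
    natCast_pred hK] at h1
  have h2 : ∑ j, (s k * ∑ a, Y ⟨k, a⟩ j ^ 2 - (∑ a, Y ⟨k, a⟩ j) ^ 2)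
      ≤ ∑ j, ∑ k, (s k * ∑ a, Y ⟨k, a⟩ j ^ 2 - (∑ a, Y ⟨k, a⟩ j) ^ 2) :=
    Finset.sum_le_sum fun j _ => Finset.single_le_sum
      (f := fun k => s k * ∑ a, Y ⟨k, a⟩ j ^ 2 - (∑ a, Y ⟨k, a⟩ j) ^ 2)
      (fun k _ => sub_nonneg.2 (sq_sum_cluster_le (fun v => Y v j) k)) (Finset.mem_univ k)
  have h3 := mul_le_mul_of_nonneg_left h2 (by linarith : 0 ≤ 1 - p)
  linarith

theorem IsSpectralSolution.cluster_sum_sq_le (hK : 2 ≤ K) (hs : ∀ k, K + 1 ≤ s k)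
    (hA : ∀ k, ∃ r, A k = SimpleGraph.starGraph r) (hp : 0 ≤ p) (h : Concentrated A p δ H)
    {Y : Matrix (Node s) (Fin (K - 1)) ℝ} (hY : IsSpectralSolution (laplacian H) Y) (k : Fin K)
    (j : Fin (K - 1)) :
    p * (∑ a, Y ⟨k, a⟩ j) ^ 2 ≤ ((K : ℝ) - 1) * (1 + 2 * (δ * total s)) := by
  have : Nonempty (Fin K) := ⟨⟨0, by omega⟩⟩
  obtain ⟨k₀, hk⟩ := exists_eq_nmax s
  obtain ⟨r, hr⟩ := hA k₀
  have h1 := h.sum_meanEnergy_le (by omega)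
    (exists_feasible_singleCluster (by omega) k₀ (hs k₀) hr p) hY
  have h2 := Finset.sum_le_sum fun (j : Fin (K - 1)) (_ : j ∈ Finset.univ) =>
    le_meanEnergy (A := A) hp (fun v => Y v j)
  simp only [feasible.sum_sq hY.1, mul_one, Finset.sum_add_distrib, ← Finset.mul_sum] at h2
  simp only [Finset.sum_const, Finset.card_univ, Fintype.card_fin, nsmul_eq_mul,
    natCast_pred (by omega : 1 ≤ K)] at h2
  have h3 : (∑ a, Y ⟨k, a⟩ j) ^ 2 ≤ ∑ k, (∑ a, Y ⟨k, a⟩ j) ^ 2 :=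
    Finset.single_le_sum (f := fun k => (∑ a, Y ⟨k, a⟩ j) ^ 2)
      (fun k _ => sq_nonneg _) (Finset.mem_univ k)
  have h4 : ∑ k, (∑ a, Y ⟨k, a⟩ j) ^ 2 ≤ ∑ j, ∑ k, (∑ a, Y ⟨k, a⟩ j) ^ 2 :=
    Finset.single_le_sum (f := fun j => ∑ k, (∑ a, Y ⟨k, a⟩ j) ^ 2)
      (fun j _ => Finset.sum_nonneg fun k _ => sq_nonneg _) (Finset.mem_univ j)
  have h5 := mul_le_mul_of_nonneg_left (h3.trans h4) hp
  rw [hk] at h1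
  linarith

end Deterministic

/-! ### Bounds after division by the number of nodes -/

section Normalized

variable {K : ℕ} {s : Fin K → ℕ} {A : ∀ k, SimpleGraph (Fin (s k))} {p δ : ℝ}
  {H : SimpleGraph (Node s)}

theorem normalizedSum_complete_bounds (hK : 1 ≤ K) (hs : ∀ k, 0 < s k) (hn : 0 < total s)
    (hA : ∀ k, A k = ⊤) (hp : p ≤ 1) (h : Concentrated A p δ H) :
    ((K : ℝ) - 1) * (p - δ) ≤ normalizedSum H ∧ normalizedSum H ≤ ((K : ℝ) - 1) * (p + δ) := by
  obtain ⟨h1, h2⟩ := partialEigSum_complete_bounds hK hs hA hp h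
  rw [normalizedSum, le_div_iff₀ hn, div_le_iff₀ hn]
  constructor <;> linarith

theorem normalizedSum_star_bounds (hK : 2 ≤ K) (hs : ∀ k, K + 1 ≤ s k) (hn : 0 < total s)
    (hA : ∀ k, ∃ r, A k = SimpleGraph.starGraph r) (hp : 0 ≤ p) (h : Concentrated A p δ H) :
    ((K : ℝ) - 1) * (p * (1 - nmax s / total s) - δ) ≤ normalizedSum H ∧
      normalizedSum H ≤ ((K : ℝ) - 1) * (1 / total s + p * (1 - nmax s / total s) + δ) := by
  obtain ⟨h1, h2⟩ := partialEigSum_star_bounds hK hs hA hp h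
  have e : nmax s / total s * total s = nmax s := div_mul_cancel₀ _ hn.ne'
  have e' : 1 / total s * total s = 1 := div_mul_cancel₀ _ hn.ne'
  rw [normalizedSum, le_div_iff₀ hn, div_le_iff₀ hn]
  constructor
  · calc _ = ((K : ℝ) - 1) * (p * (total s - nmax s / total s * total s) - δ * total s) := by ring
      _ ≤ _ := by rwa [e]
  · calc _ ≤ ((K : ℝ) - 1) * (1 / total s * total s
          + p * (total s - nmax s / total s * total s) + δ * total s) := by rwa [e, e']
      _ = _ := by ring

theorem one_div_le_nmax_div_total (hK : 1 ≤ K) (hn : 0 < total s) :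
    1 / (K : ℝ) ≤ nmax s / total s := by
  have : (0 : ℝ) < K := by exact_mod_cast hK
  rw [div_le_div_iff₀ this hn]
  linarith [total_le_mul_nmax s]

/-- With `v = 1ᵀy / √n`, the vector `v 1 / √n` is the projection of `y` onto constants; this is the
choice of `v` in the eigenvector threshold. -/
theorem sum_sub_mean_sq {n : ℕ} (hn : 0 < n) (y : Fin n → ℝ) :
    ∑ a, (y a - (∑ b, y b) / √(n : ℝ) / √(n : ℝ)) ^ 2
      = (n * ∑ a, y a ^ 2 - (∑ a, y a) ^ 2) / n := by
  have hn' : (n : ℝ) ≠ 0 := by exact_mod_cast hn.ne'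
  have e : ∀ a, (y a - (∑ b, y b) / √(n : ℝ) / √(n : ℝ)) ^ 2
      = y a ^ 2 - 2 * ((∑ b, y b) / n) * y a + ((∑ b, y b) / n) ^ 2 := by
    intro a
    rw [div_div, Real.mul_self_sqrt (Nat.cast_nonneg _)]; ring
  simp only [e, Finset.sum_add_distrib, Finset.sum_sub_distrib, ← Finset.mul_sum,
    Finset.sum_const, Finset.card_univ, Fintype.card_fin, nsmul_eq_mul]
  field_simp
  ring

end Normalized

/-! ### Limits along the growing sequence -/

section Asymptotics

variable {K : ℕ} {size : ℕ → Fin K → ℕ} {c : ℝ}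

theorem IsGrowing.eventually_le_size (h : IsGrowing size c) (M : ℕ) :
    ∀ᶠ m in atTop, ∀ k, M ≤ size m k :=
  eventually_all.2 fun k => (h.tendsto_size k).eventually_ge_atTop M

theorem IsGrowing.tendsto_total (h : IsGrowing size c) :
    Tendsto (fun m => total (size m)) atTop atTop :=
  tendsto_atTop_mono h.le_total tendsto_natCast_atTop_atTop

theorem IsGrowing.tendsto_one_div_total (h : IsGrowing size c) :
    Tendsto (fun m => 1 / total (size m)) atTop (𝓝 0) := by
  simp only [one_div]
  exact h.tendsto_total.inv_tendsto_atTop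

/-- Eventually `n_min / n_max > c / 2`, so `n ≤ K n_max ≤ (2K / c) nₖ`: an error `o(n)` is also
`o(nₖ)`. -/
theorem IsGrowing.eventually_total_le (h : IsGrowing size c) (hK : 1 ≤ K) :
    ∃ C > 0, ∀ᶠ m in atTop, ∀ k, total (size m) ≤ C * size m k := by
  have hc := h.pos
  have hK' : (0 : ℝ) < K := by exact_mod_cast hK
  refine ⟨K * (2 / c), by positivity, ?_⟩
  filter_upwards [h.eventually_le_size 1,
    h.tendsto_ratio.eventually_const_lt (half_lt_self hc)] with m hm hr k
  have hpos : 0 < nmax (size m) :=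
    lt_of_lt_of_le (by exact_mod_cast hm k) (le_nmax (size m) k)
  rw [lt_div_iff₀ hpos] at hr
  have h1 : nmax (size m) ≤ 2 / c * size m k := by
    rw [div_mul_eq_mul_div, le_div_iff₀ hc]
    linarith [nmin_le (size m) k]
  calc total (size m) ≤ K * nmax (size m) := total_le_mul_nmax _
    _ ≤ K * (2 / c * size m k) := by gcongr
    _ = _ := by ring

theorem IsGrowing.le_one (h : IsGrowing size c) (hK : 1 ≤ K) : c ≤ 1 := by
  have : Nonempty (Fin K) := ⟨⟨0, hK⟩⟩
  exact le_of_tendsto h.tendsto_ratio (Eventually.of_forall fun m =>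
    div_le_one_of_le₀ (nmin_le_nmax _) (nmax_nonneg _))

variable {A : ∀ m k, SimpleGraph (Fin (size m k))} {H : (m : ℕ) → SimpleGraph (Node (size m))}
  {p : ℝ}

theorem tendsto_normalizedSum_complete (hgrow : IsGrowing size c) (hK : 1 ≤ K)
    (hA : ∀ m k, A m k = ⊤) (hp : p ≤ 1)
    (hH : ∀ ε > 0, ∀ᶠ m in atTop, Concentrated (A m) p ε (H m)) :
    Tendsto (fun m => normalizedSum (H m)) atTop (𝓝 (((K : ℝ) - 1) * p)) := by
  refine Metric.tendsto_nhds.2 fun ε hε => ?_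
  have hK' : (0 : ℝ) < K := by exact_mod_cast hK
  filter_upwards [hH (ε / K) (by positivity), hgrow.eventually_le_size 1,
    hgrow.tendsto_total.eventually_gt_atTop 0] with m h hs hn
  obtain ⟨h1, h2⟩ := normalizedSum_complete_bounds hK hs hn (hA m) hp h
  have h3 : (K : ℝ) * (ε / K) = ε := by field_simp
  have h4 : 0 < ε / K := by positivity
  rw [Real.dist_eq, abs_lt]
  constructor <;> linarith

theorem tendsto_cluster_deviation_complete (hgrow : IsGrowing size c) (hK : 1 ≤ K)
    (hA : ∀ m k, A m k = ⊤) (hp : p < 1)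
    (hH : ∀ ε > 0, ∀ᶠ m in atTop, Concentrated (A m) p ε (H m))
    {Y : (m : ℕ) → Matrix (Node (size m)) (Fin (K - 1)) ℝ}
    (hY : ∀ᶠ m in atTop, IsSpectralSolution (laplacian (H m)) (Y m)) (k : Fin K) :
    Tendsto (fun m => ∑ a : Fin (size m k), ∑ j : Fin (K - 1),
      (Y m ⟨k, a⟩ j - (∑ b : Fin (size m k), Y m ⟨k, b⟩ j) / √(size m k : ℝ)
        / √(size m k : ℝ)) ^ 2) atTop (𝓝 0) := by
  obtain ⟨C, hC, hCs⟩ := hgrow.eventually_total_le hK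
  have hp' : 0 < 1 - p := by linarith
  have hR : (0 : ℝ) ≤ (K : ℝ) - 1 := by rw [← natCast_pred hK]; positivity
  set B : ℝ := ((K : ℝ) - 1) * 2 * C / (1 - p) with hB
  have hB0 : 0 ≤ B := by positivity
  refine Metric.tendsto_nhds.2 fun ε hε => ?_
  -- Dividing by `B + 1` makes `B ε / (B + 1) < ε` strict and allows `B = 0`.
  filter_upwards [hH (ε / (B + 1)) (by positivity), hgrow.eventually_le_size 1, hCs, hY]
    with m h hs hCm hYm
  have hsk : (0 : ℝ) < size m k := by exact_mod_cast hs k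
  have h1 := hYm.cluster_deviation_le hK hs (hA m) hp.le h k
  rw [Finset.sum_comm, Finset.sum_congr rfl fun j _ =>
    sum_sub_mean_sq (hs k) (fun a => Y m ⟨k, a⟩ j), ← Finset.sum_div]
  rw [Real.dist_eq, sub_zero, abs_of_nonneg (div_nonneg (Finset.sum_nonneg fun j _ =>
    sub_nonneg.2 (sq_sum_cluster_le (fun v => Y m v j) k)) hsk.le), div_lt_iff₀ hsk]
  have hδ : 0 < ε / (B + 1) := by positivity
  have h2 : ((K : ℝ) - 1) * (2 * (ε / (B + 1) * total (size m)))
      ≤ (1 - p) * (B * (ε / (B + 1)) * size m k) := by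
    calc _ ≤ ((K : ℝ) - 1) * (2 * (ε / (B + 1) * (C * size m k))) := by
          gcongr; exact hCm k
      _ = _ := by rw [hB]; field_simp
  have h3 := le_of_mul_le_mul_left (h1.trans h2) hp'
  refine h3.trans_lt (mul_lt_mul_of_pos_right ?_ hsk)
  rw [← mul_div_assoc, div_lt_iff₀ (by positivity)]
  nlinarith

theorem le_of_complete_bound (hgrow : IsGrowing size c) (hK : 2 ≤ K) (hA : ∀ m k, A m k = ⊤)
    (hp : p ≤ 1)
    (hH : ∀ ε > 0, ∀ᶠ m in atTop, Concentrated (A m) p ε (H m))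
    (hb : ∀ ε > 0, ∀ᶠ m in atTop,
      cStar (A m) + ((K : ℝ) - 1) * (1 - nmax (size m) / total (size m)) * p - ε
        ≤ normalizedSum (H m)) : c ≤ p := by
  by_contra! hpc
  have hR : (0 : ℝ) < (K : ℝ) - 1 := by
    have : (2 : ℝ) ≤ K := by exact_mod_cast hK
    linarith
  have hK' : (0 : ℝ) < K := by linarith
  -- Eventually `n_min / n - p n_max / n ≥ (c - p) / (2K) = 2ε`, while the two error terms add up to
  -- only `ε`.
  set ε : ℝ := (c - p) / (4 * K) with hε
  have hε0 : 0 < ε := div_pos (by linarith) (by positivity)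
  obtain ⟨m, h, hbm, hs, hn, hr⟩ := (((hH (ε / 2) (by positivity)).and
    ((hb (((K : ℝ) - 1) * (ε / 2)) (by positivity)).and
    ((hgrow.eventually_le_size K).and ((hgrow.tendsto_total.eventually_gt_atTop 0).and
    (hgrow.tendsto_ratio.eventually_const_lt (show (p + c) / 2 < c by linarith)))))).exists)
  have h1 := (normalizedSum_complete_bounds (by omega)
    (fun k => (by have := hs k; omega)) hn (hA m) hp h).2
  have h2 := le_cStar_complete hK hs (hA m)
  have h3 := one_div_le_nmax_div_total (by omega) hn
  have hb0 : 0 < nmax (size m) / total (size m) := lt_of_lt_of_le (by positivity) h3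
  have hmax : 0 < nmax (size m) := by
    rcases (nmax_nonneg (size m)).lt_or_eq with h | h
    · exact h
    · rw [← h, zero_div] at hb0; exact absurd hb0 (lt_irrefl _)
  have h4 : (p + c) / 2 * (nmax (size m) / total (size m)) ≤ nmin (size m) / total (size m) := by
    rw [← mul_div_assoc]
    exact div_le_div_of_nonneg_right ((lt_div_iff₀ hmax).1 hr).le hn.le
  have h5 : (c - p) / 2 * (1 / K) ≤ (c - p) / 2 * (nmax (size m) / total (size m)) :=
    mul_le_mul_of_nonneg_left h3 (by linarith)
  have h6 : (c - p) / 2 * (1 / K) = 2 * ε := by rw [hε]; field_simp; ring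
  have h7 : ((K : ℝ) - 1) * (nmin (size m) / total (size m)
      + (1 - nmax (size m) / total (size m)) * p - ε / 2) ≤ ((K : ℝ) - 1) * (p + ε / 2) := by
    linarith
  have h8 := le_of_mul_le_mul_left h7 hR
  linarith

theorem star_bounds_eventually (hgrow : IsGrowing size c) (hK : 2 ≤ K)
    (hA : ∀ m k, ∃ r : Fin (size m k), A m k = SimpleGraph.starGraph r) (hp : 0 ≤ p)
    (hH : ∀ ε > 0, ∀ᶠ m in atTop, Concentrated (A m) p ε (H m)) {ε : ℝ} (hε : 0 < ε) :
    ∀ᶠ m in atTop,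
      |normalizedSum (H m) - ((K : ℝ) - 1) * (1 - nmax (size m) / total (size m)) * p| ≤ ε ∧
        cStar (A m) ≤ ε := by
  have hR : (0 : ℝ) < (K : ℝ) - 1 := by
    have : (2 : ℝ) ≤ K := by exact_mod_cast hK
    linarith
  set δ := ε / (2 * ((K : ℝ) - 1)) with hδ
  have hδ0 : 0 < δ := by positivity
  have e : ((K : ℝ) - 1) * δ = ε / 2 := by rw [hδ]; field_simp
  filter_upwards [hH δ hδ0, hgrow.eventually_le_size (K + 1),
    hgrow.tendsto_total.eventually_gt_atTop 0,
    hgrow.tendsto_one_div_total.eventually_lt_const hδ0] with m h hs hn h1n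
  obtain ⟨h1, h2⟩ := normalizedSum_star_bounds hK hs hn (hA m) hp h
  have h3 := cStar_star_le hK hs (hA m)
  have h4 := mul_lt_mul_of_pos_left h1n hR
  rw [mul_one_div] at h4
  refine ⟨abs_le.2 ⟨by linarith, ?_⟩, by linarith⟩
  have h5 : ((K : ℝ) - 1) * (1 / total (size m)) = ((K : ℝ) - 1) / total (size m) :=
    mul_one_div _ _
  linarith

theorem tendsto_cluster_sum_star (hgrow : IsGrowing size c) (hK : 2 ≤ K)
    (hA : ∀ m k, ∃ r : Fin (size m k), A m k = SimpleGraph.starGraph r) (hp : 0 < p)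
    (hH : ∀ ε > 0, ∀ᶠ m in atTop, Concentrated (A m) p ε (H m))
    {Y : (m : ℕ) → Matrix (Node (size m)) (Fin (K - 1)) ℝ}
    (hY : ∀ᶠ m in atTop, IsSpectralSolution (laplacian (H m)) (Y m)) (k : Fin K)
    (j : Fin (K - 1)) :
    Tendsto (fun m => (∑ a : Fin (size m k), Y m ⟨k, a⟩ j) / √(size m k : ℝ)) atTop (𝓝 0) := by
  obtain ⟨C, hC, hCs⟩ := hgrow.eventually_total_le (by omega)
  have hR : (0 : ℝ) ≤ (K : ℝ) - 1 := by rw [← natCast_pred (by omega)]; positivity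
  set B : ℝ := ((K : ℝ) - 1) * (1 + 2 * C) / p with hB
  have hB0 : 0 ≤ B := by positivity
  refine Metric.tendsto_nhds.2 fun ε hε => ?_
  set δ := ε ^ 2 / (B + 1) with hδdef
  have hδ : 0 < δ := by positivity
  -- For `nₖ ≥ 1 / δ`, the internal star energy 1 is absorbed into `δ nₖ`.
  obtain ⟨M, hM⟩ := exists_nat_ge (1 / δ)
  filter_upwards [hH δ hδ, hgrow.eventually_le_size (K + 1), hCs, hY,
    hgrow.eventually_le_size M] with m h hs hCm hYm hMs
  have hsk : (0 : ℝ) < size m k := by have := hs k; exact_mod_cast (by omega : 0 < size m k)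
  have h1 := hYm.cluster_sum_sq_le hK hs (hA m) hp.le h k j
  have h0 : 1 ≤ δ * size m k := by
    have : 1 / δ ≤ size m k := hM.trans (by exact_mod_cast hMs k)
    rwa [div_le_iff₀' hδ] at this
  have h2 : ((K : ℝ) - 1) * (1 + 2 * (δ * total (size m))) ≤ p * (B * δ * size m k) := by
    calc _ ≤ ((K : ℝ) - 1) * (δ * size m k + 2 * (δ * (C * size m k))) := by
          gcongr; exact hCm k
      _ = _ := by rw [hB]; field_simp
  have h3 := le_of_mul_le_mul_left (h1.trans h2) hp
  have h4 : B * δ < ε ^ 2 := by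
    rw [hδdef, ← mul_div_assoc, div_lt_iff₀ (by positivity)]
    nlinarith [pow_pos hε 2]
  rw [Real.dist_eq, sub_zero]
  refine abs_lt_of_sq_lt_sq ?_ hε.le
  rw [div_pow, Real.sq_sqrt hsk.le, div_lt_iff₀ hsk]
  exact h3.trans_lt (mul_lt_mul_of_pos_right h4 hsk)

end Asymptotics

/-! ### Critical values and eigenvector thresholds -/

section Main

variable {Ω : Type*} [MeasurableSpace Ω] {μ : Measure Ω} [IsProbabilityMeasure μ] {K : ℕ}
  {size : ℕ → Fin K → ℕ} {c : ℝ} {A : ∀ m k, SimpleGraph (Fin (size m k))}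
  {G : ℝ → (m : ℕ) → Ω → SimpleGraph (Node (size m))}

theorem isCriticalValue_complete (hK : 2 ≤ K) (hgrow : IsGrowing size c)
    (hG : ∀ p ∈ Set.Icc (0 : ℝ) 1, ∀ m, IsHomogeneousRIM μ (A m) p (G p m))
    (hA : ∀ m k, A m k = ⊤) : IsCriticalValue μ A G 1 where
  mem := by simp
  below p hp _ := by
    filter_upwards [ae_eventually_concentrated hgrow hp (hG p hp)] with ω hω
    exact tendsto_normalizedSum_complete hgrow (by omega) hA hp.2 hω
  above p hp h := absurd hp.2 (not_le.2 h)

theorem isEigenvectorThreshold_complete (hK : 2 ≤ K) (hgrow : IsGrowing size c)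
    (hG : ∀ p ∈ Set.Icc (0 : ℝ) 1, ∀ m, IsHomogeneousRIM μ (A m) p (G p m))
    (hA : ∀ m k, A m k = ⊤) : IsEigenvectorThreshold μ G 1 where
  below p hp h := by
    filter_upwards [ae_eventually_concentrated hgrow hp (hG p hp)] with ω hω Y hY k
    exact ⟨_, tendsto_cluster_deviation_complete hgrow (by omega) hA h hω hY k⟩
  above p hp h := absurd hp.2 (not_le.2 h)

theorem IsCriticalValue.le_of_complete (hK : 2 ≤ K) (hgrow : IsGrowing size c)
    (hG : ∀ p ∈ Set.Icc (0 : ℝ) 1, ∀ m, IsHomogeneousRIM μ (A m) p (G p m))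
    (hA : ∀ m k, A m k = ⊤) {pstar : ℝ} (h : IsCriticalValue μ A G pstar) : c ≤ pstar := by
  -- It suffices to bound `c` by every `p > p*`; values `p > 1`, outside the model, are covered by
  -- `c ≤ 1`.
  refine le_of_forall_gt_imp_ge_of_dense fun p hp => ?_
  rcases le_or_gt p 1 with hp1 | hp1
  · have hp0 : 0 ≤ p := h.mem.1.trans hp.le
    obtain ⟨ω, hω, hω'⟩ := ((ae_eventually_concentrated hgrow ⟨hp0, hp1⟩ (hG p ⟨hp0, hp1⟩)).and
      (h.above p ⟨hp0, hp1⟩ hp)).exists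
    exact le_of_complete_bound hgrow hK hA hp1 hω
      fun ε hε => (hω' ε hε).mono fun m hm => hm.1
  · exact (hgrow.le_one (by omega)).trans hp1.le

/-- Above 0 the lower bound is the true asymptotic value, since `c*ₘ → 0`; the upper bound is weaker
because `n_min ≤ n_max`. -/
theorem isCriticalValue_star (hK : 2 ≤ K) (hgrow : IsGrowing size c)
    (hG : ∀ p ∈ Set.Icc (0 : ℝ) 1, ∀ m, IsHomogeneousRIM μ (A m) p (G p m))
    (hA : ∀ m k, ∃ r : Fin (size m k), A m k = SimpleGraph.starGraph r) :
    IsCriticalValue μ A G 0 where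
  mem := by simp
  below p hp hp0 := by
    obtain rfl : p = 0 := le_antisymm hp0 hp.1
    filter_upwards [ae_eventually_concentrated hgrow hp (hG 0 hp)] with ω hω
    refine Metric.tendsto_nhds.2 fun ε hε => ?_
    filter_upwards [star_bounds_eventually hgrow hK hA le_rfl hω (half_pos hε)] with m hm
    rw [mul_zero] at hm ⊢
    rw [Real.dist_eq]
    exact hm.1.trans_lt (half_lt_self hε)
  above p hp hp0 := by
    filter_upwards [ae_eventually_concentrated hgrow hp (hG p hp)] with ω hω ε hε
    have : Nonempty (Fin K) := ⟨⟨0, by omega⟩⟩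
    have hR : (0 : ℝ) ≤ (K : ℝ) - 1 := by rw [← natCast_pred (by omega)]; positivity
    filter_upwards [star_bounds_eventually hgrow hK hA hp.1 hω (half_pos hε)] with m hm
    obtain ⟨h1, h2⟩ := abs_le.1 hm.1
    have h3 := cStar_nonneg (A m)
    have h4 : ((K : ℝ) - 1) * (1 - nmax (size m) / total (size m)) * p
        ≤ ((K : ℝ) - 1) * (1 - nmin (size m) / total (size m)) * p := by
      have := div_le_div_of_nonneg_right (nmin_le_nmax (size m)) (total_nonneg (size m))
      gcongr
    constructor <;> linarith [hm.2]

theorem isEigenvectorThreshold_star (hK : 2 ≤ K) (hgrow : IsGrowing size c)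
    (hG : ∀ p ∈ Set.Icc (0 : ℝ) 1, ∀ m, IsHomogeneousRIM μ (A m) p (G p m))
    (hA : ∀ m k, ∃ r : Fin (size m k), A m k = SimpleGraph.starGraph r) :
    IsEigenvectorThreshold μ G 0 where
  below p hp h := absurd hp.1 (not_le.2 h)
  above p hp h := by
    filter_upwards [ae_eventually_concentrated hgrow hp (hG p hp)] with ω hω Y hY k j
    exact tendsto_cluster_sum_star hgrow hK hA h hω hY k j

theorem IsCriticalValue.eq_zero_of_star (hK : 2 ≤ K) (hgrow : IsGrowing size c)
    (hG : ∀ p ∈ Set.Icc (0 : ℝ) 1, ∀ m, IsHomogeneousRIM μ (A m) p (G p m))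
    (hA : ∀ m k, ∃ r : Fin (size m k), A m k = SimpleGraph.starGraph r) {pstar : ℝ}
    (h : IsCriticalValue μ A G pstar) : pstar = 0 := by
  by_contra hne
  have hpos : 0 < pstar := lt_of_le_of_ne h.mem.1 (Ne.symm hne)
  -- The condition below the threshold includes `p = p*`, so testing it there is enough.
  obtain ⟨ω, hω, hω'⟩ := ((ae_eventually_concentrated hgrow h.mem (hG pstar h.mem)).and
    (h.below pstar h.mem le_rfl)).exists
  have hR : (0 : ℝ) < (K : ℝ) - 1 := by
    have : (2 : ℝ) ≤ K := by exact_mod_cast hK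
    linarith
  have hK' : (0 : ℝ) < K := by linarith
  -- Half of the least gap `(K - 1) p* / K` between the claimed limit and the star value.
  set ε : ℝ := ((K : ℝ) - 1) * (1 / K) * pstar / 2 with hε
  have hε0 : 0 < ε := by positivity
  obtain ⟨m, hm, hm', hn⟩ := ((star_bounds_eventually hgrow hK hA hpos.le hω hε0).and
    ((hω'.eventually_const_lt (sub_lt_self _ hε0)).and
      (hgrow.tendsto_total.eventually_gt_atTop 0))).exists
  have h1 := (abs_le.1 hm.1).2
  have h2 := one_div_le_nmax_div_total (by omega) hn
  have h3 : ((K : ℝ) - 1) * (1 - nmax (size m) / total (size m)) * pstar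
      ≤ ((K : ℝ) - 1) * (1 - 1 / K) * pstar := by gcongr
  linarith

end Main

end RIM

theorem corollary3 {Ω : Type*} [MeasurableSpace Ω] (μ : Measure Ω) [IsProbabilityMeasure μ]
    (K : ℕ) (hK : 2 ≤ K) (size : ℕ → Fin K → ℕ) (c : ℝ) (hgrow : RIM.IsGrowing size c)
    (A : ∀ m k, SimpleGraph (Fin (size m k)))
    (G : ℝ → (m : ℕ) → Ω → SimpleGraph (RIM.Node (size m)))
    (hG : ∀ p ∈ Set.Icc (0 : ℝ) 1, ∀ m, RIM.IsHomogeneousRIM μ (A m) p (G p m)) :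
    ((∀ m k, A m k = (⊤ : SimpleGraph (Fin (size m k)))) →
      (∃ pstar, RIM.IsCriticalValue μ A G pstar ∧ RIM.IsEigenvectorThreshold μ G pstar) ∧
      ∀ pstar, RIM.IsCriticalValue μ A G pstar → c ≤ pstar ∧ pstar ≤ 1) ∧
    ((∀ m k, ∃ r : Fin (size m k), A m k = SimpleGraph.starGraph r) →
      (∃ pstar, RIM.IsCriticalValue μ A G pstar ∧ RIM.IsEigenvectorThreshold μ G pstar) ∧
      ∀ pstar, RIM.IsCriticalValue μ A G pstar → pstar = 0) := by
  refine ⟨fun hA => ⟨⟨1, RIM.isCriticalValue_complete hK hgrow hG hA,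
    RIM.isEigenvectorThreshold_complete hK hgrow hG hA⟩, fun pstar h =>
      ⟨h.le_of_complete hK hgrow hG hA, h.mem.2⟩⟩,
    fun hA => ⟨⟨0, RIM.isCriticalValue_star hK hgrow hG hA,
      RIM.isEigenvectorThreshold_star hK hgrow hG hA⟩, fun pstar h =>
      h.eq_zero_of_star hK hgrow hG hA⟩⟩
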